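/- **Theorem.** Let $d\ge 2$, $k\ge 1$ be integers. Let $M\subset\mathbb{R}^d$ be compact and let $f$ be a $C^k$ diffeomorphism of $M$ onto its image $f(M)\subseteq M$ (for instance $f(M)=M$), that is, $f$ extends to a $C^k$ diffeomorphism from an open set $W\supseteq M$ onto an open subset of $\mathbb{R}^d$. Let $\mathcal{A}\subseteq M$ be an attractor of $f$: a nonempty compact set with $f(\mathcal{A})=\mathcal{A}$ that attracts all points of a neighborhood of itself. Assume that $f$ is uniformly hyperbolic on a neighborhood $\mathscr{V}\subseteq W$ of $\mathcal{A}$ in $\mathbb{R}^d$ (there is a continuous $Df$-invariant splitting $\mathbb{R}^d=E^s(x)\oplus E^u(x)$, $x\in\mathscr{V}$, such that, along orbit segments contained in $\mathscr V$, $Df^n$ contracts $E^s$ and expands $E^u$ at uniform exponential rates), and let $\lambda_-<0<\lambda_+$ be two numbers such that $$\sup_{x\in\mathscr{V}}\|D_xf\|\le e^{\lambda_+}\qquad\text{and}\qquad d\big(f(y),\mathcal{A}\big)\le e^{\lambda_-}\,d\big(y,\mathcal{A}\big)\quad\text{for all } y\in\mathscr{V}.$$ Let $N_\epsilon(\mathcal{A})$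 be the least number of balls of radius $\epsilon$ that cover $\mathcal{A}$, and let $d_{\mathcal{A}}=\limsup_{\epsilon\to0}\log N_\epsilon(\mathcal{A})/\log\epsilon^{-1}$ be the (upper) box-counting dimension of $\mathcal{A}$. If $k=1$, assume in addition that $N_\epsilon(\mathcal{A})=\mathcal{O}(\epsilon^{-d_{\mathcal{A}}})$ as $\epsilon\to0$. Fix a universal machine whose programs are finite binary sequences and whose outputs are finite sets of points of $\mathbb{R}^d$ with rational coordinates. (Universal means: partial computable, and able to simulate every partial computable machine with programs longer by at most a constant depending only on that machine.) For $\epsilon>0$ let $\Delta_\epsilon(\mathcal{A})$, the $\epsilon$-distortion complexity of $\mathcal{A}$, be the least length of a program that halts and outputs a finite set at Hausdorff distance at most $\epsilon$ from $\mathcal{A}$. Then there are constants $C>0$ and $\epsilon_0>0$ (independent of $\epsilon$) such that for all $0<\epsilon<\epsilon_0$ $$\Delta_\epsilon(\mathcal{A})\le C\,\epsilon^{-d_{\mathcal{A}}(\lambda_+-\lambda_- /k)/(\lambda_+-\lambda_-)}\,\big(\log\epsilon^{-1}\big)^2 .$$ -/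

import Mathlib

open Set Filter Topology

noncomputable section

namespace Distortion

/-! ### Programs and distortion complexity -/

/-- A machine working on finite binary programs.  When it halts it outputs a finite list of points
of `ℚᵈ`; each coordinate is given as a pair `(a, b)` standing for the rational `a / (b + 1)`. -/
abbrev Machine (d : ℕ) : Type := List Bool →. List (Fin d → ℤ × ℕ)

/-- Universal machine in the sense of Kolmogorov complexity: it is partial computable, and it
simulates every partial computable machine with programs that are longer by at most a constant
depending only on the simulated machine. -/
def IsUniversal {d : ℕ} (U : Machine d) : Prop :=
  Partrec U ∧ ∀ D : Machine d, Partrec D →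
    ∃ c : ℕ, ∀ (p : List Bool) (L : List (Fin d → ℤ × ℕ)), L ∈ D p →
      ∃ q : List Bool, q.length ≤ p.length + c ∧ L ∈ U q

/-- Universal machines exist: on the program `1ᵉ0p`, run the `e`-th partial recursive function
on `p`. -/
theorem exists_isUniversal (d : ℕ) : ∃ U : Machine d, IsUniversal U := by
  let idx : List Bool → ℕ := fun s => s.findIdx (fun b => !b)
  let out : ℕ → Option (List (Fin d → ℤ × ℕ)) :=
    @Encodable.decode _ Primcodable.toEncodable
  refine ⟨fun s => (Nat.Partrec.Code.eval (Denumerable.ofNat Nat.Partrec.Code (idx s))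
      (Encodable.encode (s.drop (idx s + 1)))).bind (fun n => (out n : Part _)), ?_, ?_⟩
  · have hidx : Computable idx := by
      have : Primrec idx := Primrec.list_findIdx Primrec.id (Primrec.not.comp Primrec.snd).to₂
      exact this.to_comp
    have hdrop : Computable fun s : List Bool => Encodable.encode (s.drop (idx s + 1)) :=
      Computable.encode.comp
        (Primrec.list_drop.to_comp.comp (Computable.succ.comp hidx) Computable.id)
    have hcode : Computable fun s : List Bool => Denumerable.ofNat Nat.Partrec.Code (idx s) :=
      (Computable.ofNat _).comp hidx
    refine Partrec.bind (Nat.Partrec.Code.eval_part.comp hcode hdrop) ?_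
    exact Computable.ofOption (Computable.decode.comp Computable.snd)
  · intro D hD
    obtain ⟨c, hc⟩ := Nat.Partrec.Code.exists_code.1 hD
    refine ⟨Encodable.encode c + 1, fun p L hL =>
      ⟨List.replicate (Encodable.encode c) true ++ false :: p, ?_, ?_⟩⟩
    · simp; omega
    · have h1 : idx (List.replicate (Encodable.encode c) true ++ false :: p)
          = Encodable.encode c := by
        simp only [idx]
        generalize Encodable.encode c = e
        induction e with
        | zero => simp [List.findIdx_cons]
        | succ e ih => simp [List.replicate_succ, List.findIdx_cons, ih]
      have h2 : (List.replicate (Encodable.encode c) true ++ false :: p).drop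
          (Encodable.encode c + 1) = p := by
        generalize Encodable.encode c = e
        induction e with
        | zero => simp
        | succ e ih => simpa [List.replicate_succ] using ih
      simp only [h1, h2, Denumerable.ofNat_encode, hc]
      simp only [Encodable.encodek, Part.coe_some, Part.bind_some]
      refine Part.mem_bind (Part.mem_map (@Encodable.encode _ Primcodable.toEncodable) hL) ?_
      have h3 : out (@Encodable.encode _ Primcodable.toEncodable L) = some L :=
        @Encodable.encodek _ Primcodable.toEncodable L
      rw [h3]; exact Part.mem_some L

/-- The point of `ℝᵈ` with the rational coordinates `x`. -/
def ratPoint {d : ℕ} (x : Fin d → ℤ × ℕ) : EuclideanSpace ℝ (Fin d) :=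
  WithLp.toLp 2 fun i => ((x i).1 : ℝ) / (((x i).2 : ℝ) + 1)

/-- The finite set of points listed by an output. -/
def pointSet {d : ℕ} (L : List (Fin d → ℤ × ℕ)) : Set (EuclideanSpace ℝ (Fin d)) :=
  ratPoint '' {x | x ∈ L}

/-- The `ε`-distortion complexity of `F` with respect to the machine `U`: the least length of a
program which halts and outputs a finite set at Hausdorff distance at most `ε` from `F`
(`⊤` if there is no such program). -/
def distortionComplexity {d : ℕ} (U : Machine d) (ε : ℝ)
    (F : Set (EuclideanSpace ℝ (Fin d))) : ℕ∞ :=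
  ⨅ p ∈ {p : List Bool | ∃ L ∈ U p,
    Metric.hausdorffEDist F (pointSet L) ≤ ENNReal.ofReal ε}, (p.length : ℕ∞)

/-! ### Box-counting dimension -/

/-- The least number of closed balls of radius `ε` that cover `A` (meaningful for bounded `A`). -/
def boxCount {d : ℕ} (A : Set (EuclideanSpace ℝ (Fin d))) (ε : ℝ) : ℝ :=
  ((Metric.externalCoveringNumber ε.toNNReal A).toNat : ℝ)

/-- The upper box-counting dimension of a nonempty bounded set; it is the box-counting dimension
whenever the limit exists. -/
def boxDim {d : ℕ} (A : Set (EuclideanSpace ℝ (Fin d))) : ℝ :=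
  limsup (fun ε : ℝ => Real.log (boxCount A ε) / Real.log ε⁻¹) (𝓝[>] 0)

/-! ### Dynamics -/

variable {E : Type*} [NormedAddCommGroup E] [NormedSpace ℝ E]

/-- `f` is a `Cᵏ` diffeomorphism of `M` onto its image `f(M) ⊆ M`, given by a `Cᵏ` diffeomorphism
of the open neighbourhood `W` of `M` onto the open set `f(W)`. -/
def IsDiffeoOn (k : ℕ) (f : E → E) (M W : Set E) : Prop :=
  IsOpen W ∧ M ⊆ W ∧ MapsTo f M M ∧ ContDiffOn ℝ k f W ∧ IsOpen (f '' W) ∧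
    ∃ g : E → E, LeftInvOn g f W ∧ ContDiffOn ℝ k g (f '' W)

/-- `A ⊆ M` is an attractor of `f`: a nonempty compact invariant set which attracts all points of
one of its neighbourhoods.  No indecomposability (such as a dense orbit) is required. -/
def IsAttractor (f : E → E) (M A : Set E) : Prop :=
  A ⊆ M ∧ A.Nonempty ∧ IsCompact A ∧ f '' A = A ∧
    ∃ V ∈ 𝓝ˢ A, ∀ x ∈ V, Tendsto (fun n : ℕ => Metric.infDist (f^[n] x) A) atTop (𝓝 0)

/-- `f` is uniformly hyperbolic on `V`: there is a continuous splitting `E = Eˢ(x) ⊕ Eᵘ(x)`,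
`x ∈ V`, invariant under the derivative of `f`, such that along orbit segments contained in `V`
the derivatives of the iterates contract `Eˢ` and expand `Eᵘ` at uniform exponential rates.
The splitting is given by the projections `P x` onto `Eˢ(x) = range (P x)`
along `Eᵘ(x) = ker (P x)`. -/
def UniformlyHyperbolicOn (f : E → E) (V : Set E) : Prop :=
  ∃ (P : E → E →L[ℝ] E) (c μ : ℝ), 0 < c ∧ 0 < μ ∧ μ < 1 ∧
    ContinuousOn P V ∧
    (∀ x ∈ V, P x ∘L P x = P x) ∧
    (∀ x ∈ V, f x ∈ V → P (f x) ∘L fderiv ℝ f x = fderiv ℝ f x ∘L P x) ∧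
    ∀ x, ∀ n : ℕ, (∀ i ≤ n, f^[i] x ∈ V) →
      (∀ v, P x v = v → ‖fderiv ℝ (f^[n]) x v‖ ≤ c * μ ^ n * ‖v‖) ∧
      (∀ v, P x v = 0 → ‖v‖ ≤ c * μ ^ n * ‖fderiv ℝ (f^[n]) x v‖)

end Distortion

end

namespace Distortion

/-! ### Primitive recursive building blocks -/

/-! For `k ≥ 2` the attractor `A` is described at scale `ε` by data at a coarser scale `δ = ε ^ θ`,
`θ < 1`: a cover of `A` by about `δ ^ (-s)` cells, on each cell a polynomial approximating `f` up to
`O(δ ^ k)` (`exists_poly_approx`, `exists_cells`), and a number `n ≈ β log (1 / ε)` of iterations.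
The decoder applies the `n`-th iterate of this piecewise polynomial map to a fine grid of points
near the cell centres.

Every output is close to `A`: contraction towards `A` leaves a distance of order `e^(λ₋ n) δ + δ ^
k` (`infDist_pseudoOrbit_le`), which is small enough if `-λ₋ β + θ > 1` and `k θ > 1`. Every point
of `A` is close to an output: since `f(A) = A`, it has the form `f^n b` with `b ∈ A`, and the
pseudo-orbit of a grid point next to `b` ends at a distance of order `e^(λ₊ n) δ ^ k` from it
(`norm_pseudoOrbit_sub_le`), which is small enough if `k θ - λ₊ β > 1`. All numbers in the
description are polynomial in `1 / ε`, so each costs `O(log (1 / ε))` bits, and the program has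
length `O(ε ^ (-θ s) log (1 / ε))`.

A suitable `β` exists as soon as `θ > (λ₊ - λ₋) / (λ₊ - k λ₋)`. This threshold lies strictly below
`α = (λ₊ - λ₋ / k) / (λ₊ - λ₋)`, because `k + 1 / k > 2` (`exists_exponents`). The gap pays for the
use of an upper dimension: with `θ < α` and `D = boxDim A > 0`, the number `s = D α / θ` exceeds
`D`, so the covering numbers are eventually at most `δ ^ (-s)`, while `θ s = D α` is exactly the
exponent claimed.

Two cases escape this argument. If `k = 1`, then `α = 1`, and listing the centres of a cover
suffices. If `k ≥ 2` and `D = 0` there is no room for `s`; here hyperbolicity helps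
(`boxCount_bounded_or_boxDim_pos`). Without unstable directions over `A` the covering numbers are
bounded, and a list suffices again. With an unstable direction, small segments are stretched to a
fixed size while they are attracted to `A`, so at least `c / ε` balls are needed and `D > 0`. -/

theorem primrec_int_sub : Primrec₂ fun a b : ℕ => (a : ℤ) - (b : ℤ) := by
  have h : Primrec fun p : ℕ × ℕ =>
      if p.2 ≤ p.1 then 2 * (p.1 - p.2) else 2 * (p.2 - p.1 - 1) + 1 := by
    refine Primrec.ite (Primrec.nat_le.comp Primrec.snd Primrec.fst) ?_ ?_
    · exact Primrec.nat_double.comp (Primrec.nat_sub.comp Primrec.fst Primrec.snd)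
    · exact Primrec.nat_double_succ.comp (Primrec.nat_sub.comp
        (Primrec.nat_sub.comp Primrec.snd Primrec.fst) (Primrec.const 1))
  refine Primrec.encode_iff.1 (h.of_eq ?_)
  rintro ⟨a, b⟩
  -- The encoding of `ℤ` sends `n` to `2 * n` and `-n - 1` to `2 * n + 1`, which reduces the claim
  -- to arithmetic in `ℕ`.
  have h1 : ∀ n : ℕ, Encodable.encode (n : ℤ) = 2 * n := fun n => rfl
  have h2 : ∀ n : ℕ, Encodable.encode (Int.negSucc n) = 2 * n + 1 := fun n => rfl
  dsimp only
  split_ifs with hab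
  · rw [← Nat.cast_sub hab]; exact (h1 _).symm
  · have : (a : ℤ) - b = Int.negSucc (b - a - 1) := by omega
    rw [this, h2]

theorem primrec_list_sum {α : Type*} [Primcodable α] {f : α → List ℕ} (hf : Primrec f) :
    Primrec fun x => (f x).sum :=
  (Primrec.list_foldr (h := fun _ p => p.1 + p.2) hf (Primrec.const 0)
    (Primrec.nat_add.comp (Primrec.fst.comp Primrec.snd) (Primrec.snd.comp Primrec.snd)).to₂).of_eq
    fun x => by simp [List.sum]

theorem primrec_list_prod {α : Type*} [Primcodable α] {f : α → List ℕ} (hf : Primrec f) :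
    Primrec fun x => (f x).prod :=
  (Primrec.list_foldr (h := fun _ p => p.1 * p.2) hf (Primrec.const 1)
    (Primrec.nat_mul.comp (Primrec.fst.comp Primrec.snd) (Primrec.snd.comp Primrec.snd)).to₂).of_eq
    fun x => by simp [List.prod]

theorem primrec_sum_fintype {α ι : Type*} [Primcodable α] [Primcodable ι] [Fintype ι]
    {f : α → ι → ℕ} (hf : Primrec₂ f) : Primrec fun x => ∑ i, f x i :=
  (primrec_list_sum (Primrec.list_map
    (Primrec.const (Finset.univ : Finset ι).toList) hf)).of_eq fun x => by simp

theorem primrec_prod_fintype {α ι : Type*} [Primcodable α] [Primcodable ι] [Fintype ι]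
    {f : α → ι → ℕ} (hf : Primrec₂ f) : Primrec fun x => ∏ i, f x i :=
  (primrec_list_prod (Primrec.list_map
    (Primrec.const (Finset.univ : Finset ι).toList) hf)).of_eq fun x => by simp

theorem primrecPred_forall_fintype {α ι : Type*} [Primcodable α] [Primcodable ι] [Fintype ι]
    {p : α → ι → Prop} (hp : PrimrecRel p) : PrimrecPred fun x => ∀ i, p x i := by
  classical
  have h : PrimrecPred fun x : α => ∀ i ∈ (Finset.univ : Finset ι).toList, p x i :=
    (hp.swap.forall_mem_list).comp (Primrec.const (Finset.univ : Finset ι).toList) Primrec.id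
  exact h.of_eq fun x => by simp

theorem primrec_nat_pow : Primrec₂ fun a b : ℕ => a ^ b := 
  Primrec₂.unpaired'.1 Nat.Primrec.pow

/-! ### The decoding machine -/

/-- The `i`-th digit of `X` in base `B`. -/
def digit (B X i : ℕ) : ℕ := X / B ^ i % B

/-- Expansion in base `B`. The bound `B ^ n` matters as well: for `B = 2 ^ b` it fixes the number of
bits of a program. -/
theorem exists_digit_eq (B n : ℕ) (φ : ℕ → ℕ) (hφ : ∀ i < n, φ i < B) :
    ∃ X < B ^ n, ∀ i < n, digit B X i = φ i := by
  refine ⟨finFunctionFinEquiv (fun i : Fin n => (⟨φ i, hφ i i.2⟩ : Fin B)), Fin.is_lt _, ?_⟩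
  intro i hi
  have := congrFun (finFunctionFinEquiv.symm_apply_apply
    (fun i : Fin n => (⟨φ i, hφ i i.2⟩ : Fin B))) ⟨i, hi⟩
  have h2 := congrArg Fin.val this
  simpa [digit, finFunctionFinEquiv] using h2

/-- The number with the given binary digits, least significant digit first. -/
def bitsVal (l : List Bool) : ℕ := l.foldr (fun b n => 2 * n + b.toNat) 0

theorem exists_bitsVal_eq : ∀ (m X : ℕ), X < 2 ^ m → ∃ l : List Bool, l.length = m ∧ bitsVal l = X
  | 0, X, h => ⟨[], rfl, by simp [bitsVal]; simp at h; exact h.symm⟩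
  | m + 1, X, h => by
    obtain ⟨l, hl, hX⟩ := exists_bitsVal_eq m (X / 2) (by rw [pow_succ] at h; omega)
    refine ⟨decide (X % 2 = 1) :: l, by simp [hl], ?_⟩
    have : bitsVal (decide (X % 2 = 1) :: l) = 2 * bitsVal l + (decide (X % 2 = 1)).toNat := rfl
    rw [this, hX]
    by_cases h2 : X % 2 = 1 <;> simp [h2] <;> omega

variable {d k : ℕ}

/-- Words of length `k` in the letters `0, …, d`; they index the monomials of degree at most `k`
in `d` variables, the letter `0` standing for the constant `1`. -/
abbrev Word (d k : ℕ) : Type := Fin k → Fin (d + 1)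

/-- The first cell (a cube of side `s`, given by its lower corner) that contains `y`. -/
def cellIndex (N s : ℕ) (c : ℕ → Fin d → ℕ) (y : Fin d → ℕ) : ℕ :=
  (List.range N).findIdx fun j => decide (∀ i, c j i ≤ y i ∧ y i ≤ c j i + s)

/-- A polynomial in fixed point arithmetic with unit `1 / Q`. The coefficients are shifted by
`κ` to make them nonnegative. -/
def polyMap (κ Q : ℕ) (c : Fin d → ℕ) (a : Fin d → Word d k → ℕ) (y : Fin d → ℕ) : Fin d → ℕ :=
  fun i => (∑ w, a i w * ∏ t, (Fin.cons Q (fun l => y l - c l) : Fin (d + 1) → ℕ) (w t)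
    - κ * Q * ∑ w : Word d k, ∏ t, (Fin.cons Q (fun l => y l - c l) : Fin (d + 1) → ℕ) (w t)) / Q ^ k

/-- The piecewise polynomial map with the given cells and coefficients. -/
def cellMap (κ N s Q : ℕ) (c : ℕ → Fin d → ℕ) (a : ℕ → Fin d → Word d k → ℕ) (y : Fin d → ℕ) :
    Fin d → ℕ :=
  polyMap κ Q (c (cellIndex N s c y)) (a (cellIndex N s c y)) y

theorem primrec_polyMap {α : Type*} [Primcodable α] (κ : ℕ) {Q : α → ℕ} {c : α → Fin d → ℕ}
    {a : α → Fin d → Word d k → ℕ} {y : α → Fin d → ℕ} (hQ : Primrec Q) (hc : Primrec c)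
    (ha : Primrec fun p : α × Fin d × Word d k => a p.1 p.2.1 p.2.2) (hy : Primrec y) :
    Primrec fun x => polyMap κ (Q x) (c x) (a x) (y x) := by
  have hcons : Primrec₂ fun (x : α) (l : Fin (d + 1)) =>
      (Fin.cons (Q x) (fun l => y x l - c x l) : Fin (d + 1) → ℕ) l := by
    rw [← Primrec.fin_curry]
    refine (Primrec.vector_get'.comp (Primrec.vector_ofFn (n := d + 1)
      (f := fun l x => (Fin.cons (Q x) (fun l => y x l - c x l) : Fin (d + 1) → ℕ) l) ?_)).of_eq ?_
    · intro l
      refine Fin.cases ?_ (fun l => ?_) l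
      · simpa using hQ
      · simp only [Fin.cons_succ]
        exact Primrec.nat_sub.comp (Primrec.fin_app.comp hy (Primrec.const l))
          (Primrec.fin_app.comp hc (Primrec.const l))
    · intro x; ext l; simp
  have hprod : Primrec₂ fun (x : α) (w : Word d k) =>
      ∏ t, (Fin.cons (Q x) (fun l => y x l - c x l) : Fin (d + 1) → ℕ) (w t) := by
    refine primrec_prod_fintype (α := α × Word d k) ?_
    exact hcons.comp (Primrec.fst.comp Primrec.fst)
      (Primrec.fin_app.comp (Primrec.snd.comp Primrec.fst) Primrec.snd)
  refine Primrec.fin_curry.2 ?_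
  refine Primrec.nat_div.comp (Primrec.nat_sub.comp ?_ ?_) ?_
  · refine primrec_sum_fintype (α := α × Fin d) (ι := Word d k) (Primrec.nat_mul.comp ?_ ?_)
    · exact ha.comp (Primrec.pair (Primrec.fst.comp Primrec.fst)
        (Primrec.pair (Primrec.snd.comp Primrec.fst) Primrec.snd))
    · exact hprod.comp (Primrec.fst.comp Primrec.fst) Primrec.snd
  · refine Primrec.nat_mul.comp
      (Primrec.nat_mul.comp (Primrec.const κ) (hQ.comp Primrec.fst)) ?_
    exact (primrec_sum_fintype hprod).comp Primrec.fst
  · exact primrec_nat_pow.comp (hQ.comp Primrec.fst) (Primrec.const k)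

theorem primrec_cellIndex {α : Type*} [Primcodable α] {N s : α → ℕ} {c : α → ℕ → Fin d → ℕ}
    {y : α → Fin d → ℕ} (hN : Primrec N) (hs : Primrec s) (hc : Primrec₂ c) (hy : Primrec y) :
    Primrec fun x => cellIndex (N x) (s x) (c x) (y x) := by
  refine Primrec.list_findIdx (Primrec.list_range.comp hN) ?_
  refine PrimrecPred.decide (α := α × ℕ) ?_
  refine primrecPred_forall_fintype (α := α × ℕ) ?_
  have h1 : Primrec fun p : (α × ℕ) × Fin d => c p.1.1 p.1.2 p.2 :=
    Primrec.fin_app.comp (hc.comp (Primrec.fst.comp Primrec.fst) (Primrec.snd.comp Primrec.fst))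
      Primrec.snd
  have h2 : Primrec fun p : (α × ℕ) × Fin d => y p.1.1 p.2 :=
    Primrec.fin_app.comp (hy.comp (Primrec.fst.comp Primrec.fst)) Primrec.snd
  exact PrimrecPred.and (Primrec.nat_le.comp h1 h2)
    (Primrec.nat_le.comp h2 (Primrec.nat_add.comp h1
      (hs.comp (Primrec.fst.comp Primrec.fst))))

theorem primrec_cellMap {α : Type*} [Primcodable α] (κ : ℕ) {N s Q : α → ℕ}
    {c : α → ℕ → Fin d → ℕ} {a : α → ℕ → Fin d → Word d k → ℕ} {y : α → Fin d → ℕ}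
    (hN : Primrec N) (hs : Primrec s) (hQ : Primrec Q) (hc : Primrec₂ c)
    (ha : Primrec fun p : (α × ℕ) × Fin d × Word d k => a p.1.1 p.1.2 p.2.1 p.2.2)
    (hy : Primrec y) : Primrec fun x => cellMap κ (N x) (s x) (Q x) (c x) (a x) (y x) := by
  have hidx := primrec_cellIndex hN hs hc hy
  have hc' : Primrec fun x => c x (cellIndex (N x) (s x) (c x) (y x)) := hc.comp Primrec.id hidx
  have ha' : Primrec fun p : α × Fin d × Word d k =>
      a p.1 (cellIndex (N p.1) (s p.1) (c p.1) (y p.1)) p.2.1 p.2.2 :=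
    ha.comp (Primrec.pair (Primrec.pair Primrec.fst (hidx.comp Primrec.fst)) Primrec.snd)
  exact primrec_polyMap κ hQ hc' ha' hy

theorem primrec_bitsVal : Primrec bitsVal :=
  Primrec.list_foldr (h := fun (_ : List Bool) (p : Bool × ℕ) => 2 * p.2 + p.1.toNat) Primrec.id
    (Primrec.const 0)
    (Primrec.nat_add.comp (Primrec.nat_double.comp (Primrec.snd.comp Primrec.snd))
      ((Primrec.dom_bool Bool.toNat).comp (Primrec.fst.comp Primrec.snd))).to₂

theorem primrec_digit {α : Type*} [Primcodable α] {B X i : α → ℕ} (hB : Primrec B)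
    (hX : Primrec X) (hi : Primrec i) : Primrec fun x => digit (B x) (X x) (i x) :=
  Primrec.nat_mod.comp (Primrec.nat_div.comp hX (primrec_nat_pow.comp hB hi)) hB

/-- The fields of the description of one cell. -/
abbrev Field (d k : ℕ) : Type := Fin d × Option (Word d k)

/-- The position of the field `e` of the `j`-th cell in a description. -/
noncomputable def fieldPos (j : ℕ) (e : Field d k) : ℕ :=
  4 + (j * Fintype.card (Field d k) + Fintype.equivFin (Field d k) e)

/-- The corner of the `j`-th cell described by the digits of `X` in base `B`. -/
noncomputable def cornerOf (k B X j : ℕ) (i : Fin d) : ℕ := digit B X (fieldPos (k := k) j (i, none))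

/-- The coefficients of the `j`-th cell described by the digits of `X` in base `B`. -/
noncomputable def coeffOf (B X j : ℕ) (i : Fin d) (w : Word d k) : ℕ := digit B X (fieldPos j (i, some w))

/-- The `t`-th starting point: the cells are numbered by `t / (2u+1)ᵈ`, and the remainder
describes the offset. -/
def startPoint (u : ℕ) (c : ℕ → Fin d → ℕ) (t : ℕ) (i : Fin d) : ℕ :=
  c (t / (2 * u + 1) ^ d) i + (2 * d + 1) * u + digit (2 * u + 1) (t % (2 * u + 1) ^ d) i

/-- The output of the decoding machine on the digits of `X` in base `B`. -/
noncomputable def decodeOutput (d k σ κ B X : ℕ) : List (Fin d → ℤ × ℕ) :=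
  (List.range (digit B X 1 * (2 * digit B X 2 + 1) ^ d)).map fun t i =>
    ((((cellMap κ (digit B X 1) (2 * (2 * d + 2) * digit B X 2) (digit B X 3) (cornerOf k B X)
        (coeffOf (k := k) B X))^[digit B X 0] (startPoint (digit B X 2) (cornerOf k B X) t) i : ℕ) : ℤ)
      - (σ * digit B X 3 : ℕ), digit B X 3 - 1)

theorem primrec_fieldPos {α : Type*} [Primcodable α] {j : α → ℕ} {e : α → Field d k}
    (hj : Primrec j) (he : Primrec e) : Primrec fun x => fieldPos (j x) (e x) :=
  Primrec.nat_add.comp (Primrec.const 4) (Primrec.nat_add.comp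
    (Primrec.nat_mul.comp hj (Primrec.const _))
    ((Primrec.dom_finite fun e : Field d k => (Fintype.equivFin (Field d k) e : ℕ)).comp he))

/-- Computability of the decoder is what allows a universal machine to simulate it at the price of
an additive constant. Everything is elementary arithmetic and a bounded search, with the number of
iterations read from the input. -/
theorem primrec_decodeOutput (d k σ κ : ℕ) : Primrec₂ (decodeOutput d k σ κ) := by
  have hdig : ∀ {α : Type} [Primcodable α] {q : α → ℕ × ℕ} (_ : Primrec q) (i : ℕ),
      Primrec fun x => digit (q x).1 (q x).2 i := fun hq i =>
    primrec_digit (Primrec.fst.comp hq) (Primrec.snd.comp hq) (Primrec.const i)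
  have hcorner : ∀ {α : Type} [Primcodable α] {q : α → ℕ × ℕ} {j : α → ℕ} (_ : Primrec q)
      (_ : Primrec j), Primrec fun x => (cornerOf k (q x).1 (q x).2 (j x) : Fin d → ℕ) := by
    intro α _ q j hq hj
    refine Primrec.fin_curry.2 ?_
    refine primrec_digit (Primrec.fst.comp (hq.comp Primrec.fst))
      (Primrec.snd.comp (hq.comp Primrec.fst)) (primrec_fieldPos (hj.comp Primrec.fst) ?_)
    exact Primrec.pair Primrec.snd (Primrec.const none)
  have hcoeff : ∀ {α : Type} [Primcodable α] {q : α → ℕ × ℕ} {j : α → ℕ} (_ : Primrec q)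
      (_ : Primrec j), Primrec fun p : α × Fin d × Word d k =>
        coeffOf (q p.1).1 (q p.1).2 (j p.1) p.2.1 p.2.2 := by
    intro α _ q j hq hj
    refine primrec_digit (Primrec.fst.comp (hq.comp Primrec.fst))
      (Primrec.snd.comp (hq.comp Primrec.fst)) (primrec_fieldPos (hj.comp Primrec.fst) ?_)
    exact Primrec.pair (Primrec.fst.comp Primrec.snd)
      (Primrec.option_some.comp (Primrec.snd.comp Primrec.snd))
  have hside : ∀ {α : Type} [Primcodable α] {q : α → ℕ × ℕ} (_ : Primrec q),
      Primrec fun x => 2 * digit (q x).1 (q x).2 2 + 1 := fun hq =>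
    Primrec.nat_double_succ.comp (hdig hq 2)
  have hstart : Primrec fun p : (ℕ × ℕ) × ℕ =>
      startPoint (digit p.1.1 p.1.2 2) (cornerOf k p.1.1 p.1.2 : ℕ → Fin d → ℕ) p.2 := by
    have hpow : Primrec fun p : (ℕ × ℕ) × ℕ => (2 * digit p.1.1 p.1.2 2 + 1) ^ d :=
      primrec_nat_pow.comp (hside Primrec.fst) (Primrec.const d)
    refine Primrec.fin_curry.2 ?_
    refine Primrec.nat_add.comp (Primrec.nat_add.comp ?_ ?_) ?_
    · exact Primrec.fin_app.comp (hcorner (Primrec.fst.comp Primrec.fst)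
        ((Primrec.nat_div.comp Primrec.snd hpow).comp Primrec.fst)) Primrec.snd
    · exact Primrec.nat_mul.comp (Primrec.const _) (hdig (Primrec.fst.comp Primrec.fst) 2)
    · exact primrec_digit (hside (Primrec.fst.comp Primrec.fst))
        ((Primrec.nat_mod.comp Primrec.snd hpow).comp Primrec.fst)
        (Primrec.fin_val.comp Primrec.snd)
  have hmap : Primrec₂ fun (p : (ℕ × ℕ) × ℕ) (y : Fin d → ℕ) =>
      cellMap κ (digit p.1.1 p.1.2 1) (2 * (2 * d + 2) * digit p.1.1 p.1.2 2) (digit p.1.1 p.1.2 3)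
        (cornerOf k p.1.1 p.1.2) (coeffOf (k := k) p.1.1 p.1.2) y := by
    have hq : Primrec fun x : ((ℕ × ℕ) × ℕ) × (Fin d → ℕ) => x.1.1 :=
      Primrec.fst.comp Primrec.fst
    have hc : Primrec₂ fun (x : ((ℕ × ℕ) × ℕ) × (Fin d → ℕ)) (j : ℕ) =>
        (cornerOf k x.1.1.1 x.1.1.2 j : Fin d → ℕ) :=
      hcorner (α := (((ℕ × ℕ) × ℕ) × (Fin d → ℕ)) × ℕ) (q := fun x => x.1.1.1) (j := fun x => x.2)
        (hq.comp Primrec.fst) Primrec.snd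
    have hs : Primrec fun x : ((ℕ × ℕ) × ℕ) × (Fin d → ℕ) =>
        2 * (2 * d + 2) * digit x.1.1.1 x.1.1.2 2 :=
      Primrec.nat_mul.comp (Primrec.const (2 * (2 * d + 2))) (hdig hq 2)
    have ha : Primrec fun p : ((((ℕ × ℕ) × ℕ) × (Fin d → ℕ)) × ℕ) × Fin d × Word d k =>
        coeffOf p.1.1.1.1.1 p.1.1.1.1.2 p.1.2 p.2.1 p.2.2 :=
      hcoeff (α := (((ℕ × ℕ) × ℕ) × (Fin d → ℕ)) × ℕ) (q := fun x => x.1.1.1) (j := fun x => x.2)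
        (hq.comp Primrec.fst) Primrec.snd
    exact primrec_cellMap (α := ((ℕ × ℕ) × ℕ) × (Fin d → ℕ)) κ (hdig hq 1) hs (hdig hq 3) hc ha
      Primrec.snd
  have hiter := Primrec.nat_iterate (hdig (Primrec.fst (α := ℕ × ℕ) (β := ℕ)) 0) hstart hmap
  refine Primrec.list_map (α := ℕ × ℕ) ?_ ?_
  · exact Primrec.list_range.comp (Primrec.nat_mul.comp (hdig Primrec.id 1)
      (primrec_nat_pow.comp (hside Primrec.id) (Primrec.const d)))
  · refine Primrec.fin_curry.2 ?_
    refine Primrec.pair (primrec_int_sub.comp ?_ ?_) ?_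
    · exact Primrec.fin_app.comp (hiter.comp Primrec.fst) Primrec.snd
    · exact Primrec.nat_mul.comp (Primrec.const σ) (hdig (Primrec.fst.comp Primrec.fst) 3)
    · exact Primrec.nat_sub.comp (hdig (Primrec.fst.comp Primrec.fst) 3) (Primrec.const 1)

/-- The point of `ℝᵈ` with coordinates `y / Q - σ`. -/
noncomputable def gridPoint (σ Q : ℕ) (y : Fin d → ℕ) : EuclideanSpace ℝ (Fin d) :=
  WithLp.toLp 2 fun i => (y i : ℝ) / Q - σ

/-- A machine that decodes piecewise polynomial maps given in fixed point arithmetic, and outputs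
the image under an iterate of the map of the grid points near the centres of the cells. -/
theorem exists_decoder (d k σ κ : ℕ) : ∃ D : Machine d, Partrec D ∧
    ∀ (b n N u Q : ℕ) (c : ℕ → Fin d → ℕ) (a : ℕ → Fin d → Word d k → ℕ),
      n < 2 ^ b → N < 2 ^ b → u < 2 ^ b → 0 < Q → Q < 2 ^ b → (∀ j < N, ∀ i, c j i < 2 ^ b) →
      (∀ j < N, ∀ i w, a j i w < 2 ^ b) →
      ∃ (p : List Bool) (L : List (Fin d → ℤ × ℕ)) (c' : ℕ → Fin d → ℕ)
        (a' : ℕ → Fin d → Word d k → ℕ),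
        p.length = b + 1 + b * (4 + N * Fintype.card (Field d k)) ∧ L ∈ D p ∧
        (∀ j < N, c' j = c j ∧ a' j = a j) ∧
        pointSet L = {x | ∃ j < N, ∃ o : Fin d → ℕ, (∀ i, o i < 2 * u + 1) ∧
          x = gridPoint σ Q ((cellMap κ N (2 * (2 * d + 2) * u) Q c' a')^[n]
            fun i => c' j i + (2 * d + 1) * u + o i)} := by
  set idx : List Bool → ℕ := fun s => s.findIdx (fun b => !b) with hidx_def
  have hidx : Primrec idx := Primrec.list_findIdx Primrec.id (Primrec.not.comp Primrec.snd).to₂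
  refine ⟨fun s => Part.some (decodeOutput d k σ κ (2 ^ idx s) (bitsVal (s.drop (idx s + 1)))),
    ?_, ?_⟩
  · refine Computable.partrec (Primrec.to_comp ?_)
    exact (primrec_decodeOutput d k σ κ).comp (primrec_nat_pow.comp (Primrec.const 2) hidx)
      (primrec_bitsVal.comp (Primrec.list_drop.comp (Primrec.succ.comp hidx) Primrec.id))
  · intro b n N u Q c a hn hN hu hQ0 hQ hc ha
    set K := Fintype.card (Field d k) with hK
    -- The digits of the description: a header `n, N, u, Q`, then one block of `K` digits for each
    -- cell.
    set φ : ℕ → ℕ := fun i => if i = 0 then n else if i = 1 then N else if i = 2 then u else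
      if i = 3 then Q else if h : 0 < K then
        (match (Fintype.equivFin (Field d k)).symm ⟨(i - 4) % K, Nat.mod_lt _ h⟩ with
          | (l, none) => c ((i - 4) / K) l
          | (l, some w) => a ((i - 4) / K) l w) else 0 with hφ
    have hφlt : ∀ i < 4 + N * K, φ i < 2 ^ b := by
      intro i hi
      simp only [hφ]
      split_ifs with h0 h1 h2 h3 h4
      · exact hn
      · exact hN
      · exact hu
      · exact hQ
      · have hj : (i - 4) / K < N := Nat.div_lt_of_lt_mul (by rw [mul_comm]; omega)
        split
        · exact hc _ hj _
        · exact ha _ hj _ _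
      · positivity
    have hφpos : ∀ j (e : Field d k), φ (fieldPos j e) = match e with
        | (l, none) => c j l
        | (l, some w) => a j l w := by
      intro j e
      have hlt : ((Fintype.equivFin (Field d k)) e : ℕ) < K := Fin.is_lt _
      have hK0 : 0 < K := by omega
      have h1 : (fieldPos j e - 4) / K = j := by
        simp only [fieldPos, Nat.add_sub_cancel_left, ← hK]
        rw [mul_comm, Nat.mul_add_div hK0, Nat.div_eq_of_lt hlt, add_zero]
      have h2 : (⟨(fieldPos j e - 4) % K, Nat.mod_lt _ hK0⟩ : Fin K)
          = Fintype.equivFin (Field d k) e := by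
        ext
        simp only [fieldPos, Nat.add_sub_cancel_left, ← hK]
        rw [mul_comm, Nat.mul_add_mod, Nat.mod_eq_of_lt hlt]
      have h3 : ¬ fieldPos j e = 0 ∧ ¬ fieldPos j e = 1 ∧ ¬ fieldPos j e = 2 ∧
          ¬ fieldPos j e = 3 := by simp only [fieldPos]; omega
      simp only [hφ, h3, if_false, hK0, dif_pos, h1]
      rw [h2, Equiv.symm_apply_apply]
    obtain ⟨X, hX, hdig⟩ := exists_digit_eq (2 ^ b) (4 + N * K) φ hφlt
    rw [← pow_mul] at hX
    obtain ⟨l, hl, hlX⟩ := exists_bitsVal_eq _ _ hX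
    -- The initial run of `b` ones, ended by a zero, tells the decoder the base `2 ^ b`.
    have h1 : idx (List.replicate b true ++ false :: l) = b := by
      simp only [hidx_def]
      clear * -
      induction b with
      | zero => simp [List.findIdx_cons]
      | succ e ih => simp [List.replicate_succ, List.findIdx_cons, ih]
    have h2 : (List.replicate b true ++ false :: l).drop (b + 1) = l := by
      clear * -
      induction b with
      | zero => simp
      | succ e ih => simpa [List.replicate_succ] using ih
    have hpos : ∀ j < N, ∀ e : Field d k, digit (2 ^ b) X (fieldPos j e) = φ (fieldPos j e) := by
      intro j hj e
      refine hdig _ ?_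
      have hlt : ((Fintype.equivFin (Field d k)) e : ℕ) < K := Fin.is_lt _
      have : (j + 1) * K ≤ N * K := Nat.mul_le_mul_right _ hj
      simp only [fieldPos, ← hK]
      rw [add_mul] at this
      omega
    have d0 : digit (2 ^ b) X 0 = n := by rw [hdig 0 (by omega)]; simp [hφ]
    have d1 : digit (2 ^ b) X 1 = N := by rw [hdig 1 (by omega)]; simp [hφ]
    have d2 : digit (2 ^ b) X 2 = u := by rw [hdig 2 (by omega)]; simp [hφ]
    have d3 : digit (2 ^ b) X 3 = Q := by rw [hdig 3 (by omega)]; simp [hφ]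
    -- The decoded families are indexed by all of `ℕ`. They are compared with the given ones only on
    -- the `N` encoded cells.
    refine ⟨List.replicate b true ++ false :: l, _, cornerOf k (2 ^ b) X, coeffOf (2 ^ b) X, ?_,
      Part.mem_some _, ?_, ?_⟩
    · simp [hl]; omega
    · intro j hj
      refine ⟨?_, ?_⟩
      · ext i
        rw [cornerOf, hpos j hj, hφpos]
      · ext i w
        rw [coeffOf, hpos j hj, hφpos]
    · rw [h1, h2, hlX]
      simp only [decodeOutput, d0, d1, d2, d3]
      set G := cellMap κ N (2 * (2 * d + 2) * u) Q (cornerOf k (2 ^ b) X)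
        (coeffOf (k := k) (d := d) (2 ^ b) X) with hG
      set c' : ℕ → Fin d → ℕ := cornerOf k (2 ^ b) X with hc'
      have hout : ∀ z : Fin d → ℕ,
          ratPoint (fun i => ((z i : ℤ) - (σ * Q : ℕ), Q - 1)) = gridPoint σ Q z := by
        intro z
        ext i
        simp only [ratPoint, gridPoint]
        have hQ' : (Q : ℝ) ≠ 0 := by positivity
        rw [Nat.cast_sub hQ0]
        push_cast
        rw [sub_add_cancel]
        field_simp
      have hw : 0 < (2 * u + 1) ^ d := by positivity
      ext x
      simp only [pointSet, mem_image, mem_ofPred_eq, List.mem_map, List.mem_range]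
      constructor
      · rintro ⟨_, ⟨t, ht, rfl⟩, rfl⟩
        refine ⟨t / (2 * u + 1) ^ d, Nat.div_lt_of_lt_mul (by rwa [mul_comm]),
          fun i => digit (2 * u + 1) (t % (2 * u + 1) ^ d) i,
          fun i => Nat.mod_lt _ (by omega), ?_⟩
        rw [hout]
        rfl
      · rintro ⟨j, hj, o, ho, rfl⟩
        obtain ⟨t, ht, hto⟩ := exists_digit_eq (2 * u + 1) d
          (fun i => if h : i < d then o ⟨i, h⟩ else 0)
          (fun i hi => by simp only [hi, dif_pos]; exact ho _)
        refine ⟨_, ⟨(2 * u + 1) ^ d * j + t, ?_, rfl⟩, ?_⟩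
        · calc (2 * u + 1) ^ d * j + t < (2 * u + 1) ^ d * j + (2 * u + 1) ^ d := by omega
            _ = (j + 1) * (2 * u + 1) ^ d := by ring
            _ ≤ _ := Nat.mul_le_mul_right _ hj
        · rw [hout]
          have : startPoint u c' ((2 * u + 1) ^ d * j + t)
              = fun i => c' j i + (2 * d + 1) * u + o i := by
            ext i
            have hi := hto i i.2
            simp only [startPoint]
            rw [Nat.mul_add_div hw, Nat.div_eq_of_lt ht, add_zero, Nat.mul_add_mod,
              Nat.mod_eq_of_lt ht, hi]
            simp
          rw [this]

/-! ### Polynomial approximation of `Cᵏ` functions -/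

/-- The monomial in the coordinates of `h` given by a word. -/
noncomputable def monom (h : EuclideanSpace ℝ (Fin d)) (w : Word d k) : ℝ :=
  ∏ t, (Fin.cons 1 (fun i => h i) : Fin (d + 1) → ℝ) (w t)

/-- The number of letters of a word that are different from `0`. -/
def wordDeg (w : Word d k) : ℕ := ∑ t, if w t = 0 then 0 else 1

theorem monom_smul (s : ℝ) (h : EuclideanSpace ℝ (Fin d)) (w : Word d k) :
    monom (s • h) w = s ^ wordDeg w * monom h w := by
  rw [monom, monom, wordDeg, ← Finset.prod_pow_eq_pow_sum, ← Finset.prod_mul_distrib]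
  refine Finset.prod_congr rfl fun t _ => ?_
  refine Fin.cases ?_ (fun i => ?_) (w t)
  · simp
  · simp [Fin.succ_ne_zero]

theorem monom_cons (h : EuclideanSpace ℝ (Fin d)) (l : Fin (d + 1)) (w : Word d k) :
    monom h (Fin.cons l w : Word d (k + 1)) =
      (Fin.cons 1 (fun i => h i) : Fin (d + 1) → ℝ) l * monom h w := by
  rw [monom, Fin.prod_univ_succ]
  simp [monom]

theorem monom_const (h : EuclideanSpace ℝ (Fin d)) : monom h (fun _ : Fin k => 0) = 1 := by
  simp [monom]

/-- Splitting by the first letter separates the words without a leading variable from those of the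
form `hᵢ` times a shorter word; this matches the induction in `exists_poly_approx`, where one
derivative is traded for one letter. -/
theorem sum_word_succ (F : Word d (k + 1) → ℝ) :
    ∑ w, F w = ∑ w : Word d k, F (Fin.cons 0 w) +
      ∑ i : Fin d, ∑ w : Word d k, F (Fin.cons i.succ w) := by
  rw [← (Fin.consEquiv fun _ : Fin (k + 1) => Fin (d + 1)).sum_comp, Fintype.sum_prod_type,
    Fin.sum_univ_succ]
  rfl

/-- Term by term integration along a ray: `monom` is homogeneous of degree `wordDeg w`, and the
antiderivative of `s ^ m` brings the denominator `m + 1`. -/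
theorem hasDerivAt_poly (h : EuclideanSpace ℝ (Fin d)) (a : Word d k → ℝ) (s : ℝ) :
    HasDerivAt (fun s => ∑ w, a w / (wordDeg w + 1) * s ^ (wordDeg w + 1) * monom h w)
      (∑ w, a w * monom (s • h) w) s := by
  have := HasDerivAt.fun_sum (u := Finset.univ) (x := s) fun (w : Word d k) _ =>
    (((hasDerivAt_pow (wordDeg w + 1) s).const_mul (a w / (wordDeg w + 1))).mul_const (monom h w))
  refine this.congr_deriv (Finset.sum_congr rfl fun w _ => ?_)
  rw [monom_smul]
  have : (wordDeg w : ℝ) + 1 ≠ 0 := by positivity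
  push_cast
  field_simp

/-- A `Cᵏ` function is approximated on balls by polynomials with bounded coefficients, up to an
error of the order of the `k`-th power of the distance to the centre. -/
theorem exists_poly_approx (k : ℕ) : ∀ (f : EuclideanSpace ℝ (Fin d) → ℝ)
    (W K : Set (EuclideanSpace ℝ (Fin d))), IsOpen W → ContDiffOn ℝ k f W → IsCompact K → K ⊆ W →
    ∃ C : ℝ, 0 ≤ C ∧ ∀ (x : EuclideanSpace ℝ (Fin d)) (r : ℝ), Metric.closedBall x r ⊆ K →
      ∃ a : Word d k → ℝ, (∀ w, |a w| ≤ C) ∧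
        ∀ h, ‖h‖ ≤ r → |f (x + h) - ∑ w, a w * monom h w| ≤ C * ‖h‖ ^ k := by
  induction k with
  | zero =>
    intro f W K hW hf hK hKW
    obtain ⟨C, hC⟩ := hK.exists_bound_of_continuousOn (hf.continuousOn.mono hKW)
    refine ⟨max C 0, le_max_right _ _, fun x r hx => ⟨fun _ => 0, fun w => by simp, fun h hh => ?_⟩⟩
    have := hC (x + h) (hx (by simpa [dist_eq_norm] using hh))
    simpa using Or.inl this
  | succ k ih =>
    intro f W K hW hf hK hKW
    have hpart : ∀ i : Fin d, ContDiffOn ℝ k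
        (fun y => fderiv ℝ f y (EuclideanSpace.single i 1)) W := fun i =>
      (hf.fderiv_of_isOpen hW (by push_cast; exact le_rfl)).clm_apply contDiffOn_const
    choose C hC0 hC using fun i => ih _ W K hW (hpart i) hK hKW
    obtain ⟨C', hC'⟩ := hK.exists_bound_of_continuousOn (hf.continuousOn.mono hKW)
    have hCs : ∀ i, C i ≤ ∑ i, C i := fun i =>
      Finset.single_le_sum (fun j _ => hC0 j) (Finset.mem_univ i)
    have hS : 0 ≤ ∑ i, C i := Finset.sum_nonneg fun i _ => hC0 i
    refine ⟨max C' 0 + ∑ i, C i, by positivity, fun x r hx => ?_⟩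
    rcases lt_or_ge r 0 with hr | hr
    · exact ⟨fun _ => 0, fun w => by simp; positivity, fun h hh =>
        absurd (hh.trans_lt hr) (not_lt.2 (norm_nonneg h))⟩
    choose a ha hah using fun i => hC i x r hx
    have hfx : |f x| ≤ max C' 0 := (hC' x (hx (by simpa using hr))).trans (le_max_left _ _)
    -- These coefficients come from integrating the approximations of the partial derivatives over
    -- the ray from `x` to `x + h`. The constant `f x` is carried by the word of zeros, and the
    -- other words beginning with `0` get coefficient zero.
    set b : Word d (k + 1) → ℝ := fun w =>
      (Fin.cons (if (Fin.tail w : Word d k) = (fun _ => 0) then f x else 0)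
        (fun i => a i (Fin.tail w) / (wordDeg (Fin.tail w : Word d k) + 1)) :
          Fin (d + 1) → ℝ) (w 0) with hb
    have hb0 : ∀ w : Word d k, b (Fin.cons 0 w) = if w = (fun _ => 0) then f x else 0 := by
      intro w; simp [hb]
    have hbs : ∀ i (w : Word d k), b (Fin.cons i.succ w) = a i w / (wordDeg w + 1) := by
      intro i w; simp [hb]
    refine ⟨b, fun w => ?_, fun h hh => ?_⟩
    · rw [← Fin.cons_self_tail w]
      refine Fin.cases ?_ (fun i => ?_) (w 0)
      · rw [hb0]
        split_ifs
        · linarith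
        · simp; positivity
      · rw [hbs, abs_div, abs_of_nonneg (by positivity : (0 : ℝ) ≤ (wordDeg (Fin.tail w : Word d k)) + 1)]
        refine (div_le_self (abs_nonneg _) (by simp)).trans ?_
        exact (ha i _).trans ((hCs i).trans (by simp))
    · have hsum : ∑ w, b w * monom h w = f x +
          ∑ i, h i * ∑ w, a i w / (wordDeg w + 1) * (1 : ℝ) ^ (wordDeg w + 1) * monom h w := by
        rw [sum_word_succ]
        congr 1
        · rw [Finset.sum_eq_single (fun _ => 0)]
          · rw [hb0, monom_cons, monom_const]; simp
          · intro w _ hw; rw [hb0, if_neg hw, zero_mul]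
          · simp
        · refine Finset.sum_congr rfl fun i _ => ?_
          rw [Finset.mul_sum]
          refine Finset.sum_congr rfl fun w _ => ?_
          rw [hbs, monom_cons]; simp; ring
      have hmem : ∀ s ∈ Icc (0 : ℝ) 1, x + s • h ∈ K := by
        intro s hs
        refine hx ?_
        rw [Metric.mem_closedBall, dist_eq_norm, add_sub_cancel_left, norm_smul, Real.norm_eq_abs,
          abs_of_nonneg hs.1]
        exact (mul_le_of_le_one_left (norm_nonneg _) hs.2).trans hh
      have hdec : ∀ y, fderiv ℝ f y h = ∑ i, h i * fderiv ℝ f y (EuclideanSpace.single i 1) := by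
        intro y
        conv_lhs => rw [← (EuclideanSpace.basisFun (Fin d) ℝ).sum_repr h, map_sum]
        simp
      -- The error along the ray. Its derivative is `∑ hᵢ` times the errors for the partial
      -- derivatives, hence `O(‖h‖ ^ (k + 1))`, and the mean value inequality on `[0, 1]` concludes.
      set g : ℝ → ℝ := fun s => f (x + s • h) -
        ∑ i, h i * ∑ w, a i w / (wordDeg w + 1) * s ^ (wordDeg w + 1) * monom h w with hg
      have hderiv : ∀ s ∈ Icc (0 : ℝ) 1, HasDerivWithinAt g
          (∑ i, h i * (fderiv ℝ f (x + s • h) (EuclideanSpace.single i 1) -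
            ∑ w, a i w * monom (s • h) w)) (Icc 0 1) s := by
        intro s hs
        have hfd : HasFDerivAt f (fderiv ℝ f (x + s • h)) (x + s • h) :=
          ((hf.contDiffAt (hW.mem_nhds (hKW (hmem s hs)))).differentiableAt
            (by simp)).hasFDerivAt
        have hline : HasDerivAt (fun s : ℝ => x + s • h) h s := by
          simpa using ((hasDerivAt_id s).smul_const h).const_add x
        have h1 := hfd.comp_hasDerivAt s hline
        have h2 := HasDerivAt.fun_sum (u := Finset.univ) (x := s) fun (i : Fin d) _ =>
          (hasDerivAt_poly h (a i) s).const_mul (h i)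
        refine ((h1.sub h2).congr_deriv ?_).hasDerivWithinAt
        rw [hdec, ← Finset.sum_sub_distrib]
        exact Finset.sum_congr rfl fun i _ => by ring
      have hbound : ∀ s ∈ Ico (0 : ℝ) 1, ‖∑ i, h i *
          (fderiv ℝ f (x + s • h) (EuclideanSpace.single i 1) - ∑ w, a i w * monom (s • h) w)‖
          ≤ (∑ i, C i) * ‖h‖ ^ (k + 1) := by
        intro s hs
        rw [Finset.sum_mul]
        refine (norm_sum_le _ _).trans (Finset.sum_le_sum fun i _ => ?_)
        have hsh : ‖s • h‖ ≤ ‖h‖ := by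
          rw [norm_smul, Real.norm_eq_abs, abs_of_nonneg hs.1]
          exact mul_le_of_le_one_left (norm_nonneg _) hs.2.le
        rw [norm_mul, pow_succ, ← mul_assoc, mul_comm]
        refine mul_le_mul ?_ (PiLp.norm_apply_le h i) (norm_nonneg _) ?_
        · refine (hah i _ (hsh.trans hh)).trans ?_
          have := hC0 i
          gcongr
        · have := hC0 i; positivity
      have hmvt := norm_image_sub_le_of_norm_deriv_le_segment_01' hderiv hbound
      have hg1 : g 1 - g 0 = f (x + h) - ∑ w, b w * monom h w := by
        rw [hsum]
        simp only [hg]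
        simp
        ring
      rw [hg1] at hmvt
      refine hmvt.trans ?_
      have : 0 ≤ max C' 0 := le_max_right _ _
      gcongr
      linarith

/-! ### Covers and the box-counting dimension -/

theorem norm_le_of_forall_abs_le {x : EuclideanSpace ℝ (Fin d)} {m : ℝ} (hm : 0 ≤ m)
    (h : ∀ i, |x i| ≤ m) : ‖x‖ ≤ d * m := by
  rw [EuclideanSpace.norm_eq]
  refine Real.sqrt_le_iff.2 ⟨by positivity, ?_⟩
  calc ∑ i, ‖x i‖ ^ 2 ≤ ∑ _i : Fin d, m ^ 2 :=
        Finset.sum_le_sum fun i _ => pow_le_pow_left₀ (norm_nonneg _) (h i) 2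
    _ = d * m ^ 2 := by simp
    _ ≤ (d * m) ^ 2 := by
        rw [mul_pow]
        refine mul_le_mul_of_nonneg_right ?_ (by positivity)
        rcases Nat.eq_zero_or_pos d with rfl | hd
        · simp
        · have : (1 : ℝ) ≤ d := by exact_mod_cast hd
          nlinarith

theorem externalCoveringNumber_le_of_finset {A : Set (EuclideanSpace ℝ (Fin d))} {ε : ℝ}
    (C : Finset (EuclideanSpace ℝ (Fin d))) (hC : ∀ a ∈ A, ∃ c ∈ C, dist a c ≤ ε) :
    Metric.externalCoveringNumber ε.toNNReal A ≤ C.card := by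
  have : Metric.IsCover ε.toNNReal A (C : Set (EuclideanSpace ℝ (Fin d))) := by
    intro a ha
    obtain ⟨c, hc, hac⟩ := hC a ha
    refine ⟨c, hc, ?_⟩
    change edist a c ≤ _
    rw [edist_dist]
    exact ENNReal.ofReal_le_ofReal hac
  simpa using this.externalCoveringNumber_le_encard

theorem boxCount_le_of_finset {A : Set (EuclideanSpace ℝ (Fin d))} {ε : ℝ}
    (C : Finset (EuclideanSpace ℝ (Fin d))) (hC : ∀ a ∈ A, ∃ c ∈ C, dist a c ≤ ε) :
    boxCount A ε ≤ C.card := by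
  have h := externalCoveringNumber_le_of_finset C hC
  rw [boxCount]
  exact_mod_cast ENat.toNat_le_of_le_natCast h

theorem externalCoveringNumber_ne_top {A : Set (EuclideanSpace ℝ (Fin d))} (hA : IsCompact A)
    {ε : ℝ} (hε : 0 < ε) : Metric.externalCoveringNumber ε.toNNReal A ≠ ⊤ := by
  obtain ⟨t, _, ht, hAt⟩ := hA.finite_cover_balls hε
  refine ne_top_of_le_ne_top (ENat.natCast_ne_top _)
    (externalCoveringNumber_le_of_finset ht.toFinset fun a ha => ?_)
  obtain ⟨c, hc, hac⟩ := mem_iUnion₂.1 (hAt ha)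
  exact ⟨c, by simpa using hc, (Metric.mem_ball.1 hac).le⟩

theorem one_le_boxCount {A : Set (EuclideanSpace ℝ (Fin d))} (hA : IsCompact A)
    (hne : A.Nonempty) {ε : ℝ} (hε : 0 < ε) : 1 ≤ boxCount A ε := by
  have h1 : 0 < Metric.externalCoveringNumber ε.toNNReal A :=
    Metric.externalCoveringNumber_pos_iff.2 hne
  have h2 := externalCoveringNumber_ne_top hA hε
  have : (Metric.externalCoveringNumber ε.toNNReal A).toNat ≠ 0 := by
    rw [Ne, ENat.toNat_eq_zero, not_or]
    exact ⟨h1.ne', h2⟩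
  rw [boxCount]
  exact_mod_cast Nat.one_le_iff_ne_zero.2 this

/-- A compact set is covered by at most `boxCount A ε` balls of radius `2ε` centred at its
points. -/
theorem exists_cover {A : Set (EuclideanSpace ℝ (Fin d))} (hA : IsCompact A) (hne : A.Nonempty)
    {ε : ℝ} (hε : 0 < ε) : ∃ (N : ℕ) (x : ℕ → EuclideanSpace ℝ (Fin d)), 0 < N ∧
      (N : ℝ) ≤ boxCount A ε ∧ (∀ j < N, x j ∈ A) ∧ ∀ a ∈ A, ∃ j < N, dist a (x j) ≤ 2 * ε := by
  have h1 := externalCoveringNumber_ne_top hA hε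
  have h2 := Metric.coveringNumber_two_mul_le_externalCoveringNumber ε.toNNReal A
  have h3 := ne_top_of_le_ne_top h1 h2
  obtain ⟨C, hCA, hfin, hcov, hcard⟩ := Metric.exists_set_encard_eq_coveringNumber h3
  have hne' : C.Nonempty := by
    obtain ⟨a, ha⟩ := hne
    obtain ⟨c, hc, _⟩ := hcov ha
    exact ⟨c, hc⟩
  obtain ⟨x0, hx0⟩ := hne'
  set e := hfin.toFinset.equivFin
  refine ⟨hfin.toFinset.card, fun j => if h : j < hfin.toFinset.card then (e.symm ⟨j, h⟩ : _)
    else x0, ?_, ?_, ?_, ?_⟩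
  · exact Finset.card_pos.2 ⟨x0, by simpa using hx0⟩
  · rw [boxCount]
    have h4 : (hfin.toFinset.card : ℕ∞) ≤ Metric.externalCoveringNumber ε.toNNReal A := by
      rw [← Set.encard_coe_eq_coe_finsetCard, hfin.coe_toFinset, hcard]
      exact h2
    exact_mod_cast ENat.toNat_le_toNat h4 h1
  · intro j hj
    simp only [hj, dif_pos]
    exact hCA (hfin.mem_toFinset.1 (e.symm ⟨j, hj⟩).2)
  · intro a ha
    obtain ⟨c, hc, hac⟩ := hcov ha
    have hac' : edist a c ≤ (2 * ε.toNNReal : NNReal) := hac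
    refine ⟨e ⟨c, by simpa using hc⟩, Fin.is_lt _, ?_⟩
    simp only [Fin.is_lt, dif_pos, Fin.eta, Equiv.symm_apply_apply]
    have := (edist_le_coe.1 hac')
    rw [← NNReal.coe_le_coe, coe_nndist] at this
    simpa [hε.le] using this

/-- An a priori bound from a cubic grid of mesh `1 / Q ≤ ε / (d + 1)`. It makes the quotient in
`boxDim` bounded above near `0`, without which the real-valued `limsup` would carry no information.
-/
theorem exists_boxCount_le_pow {A : Set (EuclideanSpace ℝ (Fin d))} (hA : IsCompact A) :
    ∃ C : ℝ, 0 < C ∧ ∀ ε : ℝ, 0 < ε → ε < 1 → boxCount A ε ≤ (C / ε) ^ d := by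
  obtain ⟨R, hR⟩ := hA.isBounded.subset_closedBall 0
  set σ := max R 0 with hσ
  have hσ0 : 0 ≤ σ := le_max_right _ _
  refine ⟨(2 * σ + 5) * (2 * (d + 1)), by positivity, fun ε hε hε1 => ?_⟩
  set Q : ℕ := ⌈((d : ℝ) + 1) / ε⌉₊ with hQ
  have hQ1 : ((d : ℝ) + 1) / ε ≤ Q := Nat.le_ceil _
  have hQpos : (0 : ℝ) < Q := lt_of_lt_of_le (by positivity) hQ1
  have hd0 : (0 : ℝ) ≤ d := Nat.cast_nonneg d
  set T : ℕ := ⌈σ * Q⌉₊ + 1 with hT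
  have hTR : (T : ℝ) ≤ σ * Q + 2 := by
    have := (Nat.ceil_lt_add_one (by positivity : 0 ≤ σ * Q)).le
    rw [hT]; push_cast; linarith
  classical
  set F : Finset (EuclideanSpace ℝ (Fin d)) :=
    (Fintype.piFinset fun _ : Fin d => Finset.Icc (-(T : ℤ)) T).image
      fun z => WithLp.toLp 2 fun i => (z i : ℝ) / Q with hF
  have hcard : F.card ≤ (2 * T + 1) ^ d := by
    refine Finset.card_image_le.trans ?_
    rw [Fintype.card_piFinset]
    simp only [Int.card_Icc, Finset.prod_const, Finset.card_univ, Fintype.card_fin]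
    refine le_of_eq ?_
    congr 1
    omega
  have hcov : boxCount A ε ≤ F.card := by
    refine boxCount_le_of_finset F fun a ha => ?_
    refine ⟨WithLp.toLp 2 fun i => ((⌊a i * Q⌋ : ℤ) : ℝ) / Q, ?_, ?_⟩
    · rw [hF, Finset.mem_image]
      refine ⟨fun i => ⌊a i * Q⌋, ?_, rfl⟩
      rw [Fintype.mem_piFinset]
      intro i
      have hai : |a i| ≤ σ := by
        refine ((PiLp.norm_apply_le a i).trans ?_).trans (le_max_left R 0)
        simpa using hR ha
      obtain ⟨h1, h2⟩ := abs_le.1 hai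
      have h3 := Nat.le_ceil (σ * Q)
      rw [Finset.mem_Icc]
      constructor
      · rw [Int.le_floor, hT]
        push_cast
        nlinarith
      · have : ((⌊a i * Q⌋ : ℤ) : ℝ) ≤ (T : ℝ) := by
          refine (Int.floor_le _).trans ?_
          rw [hT]; push_cast
          nlinarith
        exact_mod_cast this
    · rw [dist_eq_norm]
      have : ∀ i, |(a - WithLp.toLp 2 fun i => ((⌊a i * Q⌋ : ℤ) : ℝ) / Q) i| ≤ 1 / Q := by
        intro i
        simp only [PiLp.sub_apply]
        have h1 := Int.floor_le (a i * Q)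
        have h2 := (Int.lt_floor_add_one (a i * Q)).le
        rw [abs_le]
        have e : a i = a i * Q / Q := by field_simp
        rw [e, ← sub_div, ← e, neg_div', div_le_div_iff_of_pos_right hQpos,
          div_le_div_iff_of_pos_right hQpos]
        constructor <;> linarith
      refine (norm_le_of_forall_abs_le (by positivity) this).trans ?_
      rw [mul_one_div, div_le_iff₀ hQpos]
      rw [div_le_iff₀ hε] at hQ1
      linarith
  refine hcov.trans ?_
  have h1 : (F.card : ℝ) ≤ (2 * T + 1 : ℝ) ^ d := by exact_mod_cast hcard
  refine h1.trans (pow_le_pow_left₀ (by positivity) ?_ d)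
  have hQ2 : (Q : ℝ) ≤ (d + 1) / ε + 1 := (Nat.ceil_lt_add_one (by positivity)).le
  have hQ3 : (1 : ℝ) ≤ Q := by exact_mod_cast Nat.one_le_iff_ne_zero.2 (by
    rintro h; rw [h] at hQpos; simp at hQpos)
  have hQ4 : (1 : ℝ) ≤ (d + 1) / ε := by rw [le_div_iff₀ hε]; linarith
  calc (2 * T + 1 : ℝ) ≤ (2 * σ + 5) * Q := by nlinarith
    _ ≤ (2 * σ + 5) * (2 * ((d + 1) / ε)) :=
        mul_le_mul_of_nonneg_left (by linarith) (by positivity)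
    _ = _ := by ring

theorem log_boxCount_div_nonneg {A : Set (EuclideanSpace ℝ (Fin d))} (hA : IsCompact A)
    (hne : A.Nonempty) {ε : ℝ} (hε : 0 < ε) (hε1 : ε < 1) :
    0 ≤ Real.log (boxCount A ε) / Real.log ε⁻¹ :=
  div_nonneg (Real.log_nonneg (one_le_boxCount hA hne hε))
    (Real.log_nonneg ((one_le_inv₀ hε).2 hε1.le))

theorem eventually_pos_lt {b : ℝ} (hb : 0 < b) : ∀ᶠ ε : ℝ in 𝓝[>] 0, 0 < ε ∧ ε < b := 
  Ioo_mem_nhdsGT hb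

theorem tendsto_log_inv_nhdsGT : Tendsto (fun ε : ℝ => Real.log ε⁻¹) (𝓝[>] 0) atTop :=
  Real.tendsto_log_atTop.comp tendsto_inv_nhdsGT_zero

theorem isBoundedUnder_boxDim {A : Set (EuclideanSpace ℝ (Fin d))} (hA : IsCompact A) 
    (hne : A.Nonempty) : IsBoundedUnder (· ≤ ·) (𝓝[>] 0)
      (fun ε : ℝ => Real.log (boxCount A ε) / Real.log ε⁻¹) := by
  obtain ⟨C, hC, hbound⟩ := exists_boxCount_le_pow hA
  refine ⟨d * (1 + |Real.log C|), ?_⟩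
  rw [eventually_map]
  filter_upwards [eventually_pos_lt one_pos, tendsto_log_inv_nhdsGT.eventually_ge_atTop 1]
    with ε hε hlog
  rw [div_le_iff₀ (by linarith)]
  have h1 := one_le_boxCount hA hne hε.1
  refine (Real.log_le_log (by linarith) (hbound ε hε.1 hε.2)).trans ?_
  rw [Real.log_pow, div_eq_mul_inv, Real.log_mul hC.ne' (by have := hε.1; positivity), mul_assoc]
  refine mul_le_mul_of_nonneg_left ?_ (Nat.cast_nonneg d)
  have := le_abs_self (Real.log C)
  nlinarith [abs_nonneg (Real.log C)]

theorem boxDim_nonneg {A : Set (EuclideanSpace ℝ (Fin d))} (hA : IsCompact A)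
    (hne : A.Nonempty) : 0 ≤ boxDim A := by
  refine le_limsup_of_frequently_le (Eventually.frequently ?_) (isBoundedUnder_boxDim hA hne)
  filter_upwards [eventually_pos_lt one_pos] with ε hε
  exact log_boxCount_div_nonneg hA hne hε.1 hε.2

theorem eventually_boxCount_le {A : Set (EuclideanSpace ℝ (Fin d))} (hA : IsCompact A)
    (hne : A.Nonempty) {s : ℝ} (hs : boxDim A < s) :
    ∀ᶠ ε : ℝ in 𝓝[>] 0, boxCount A ε ≤ ε ^ (-s) := by
  filter_upwards [eventually_lt_of_limsup_lt hs (isBoundedUnder_boxDim hA hne),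
    eventually_pos_lt one_pos, tendsto_log_inv_nhdsGT.eventually_ge_atTop 1] with ε h hε hlog
  rw [div_lt_iff₀ (by linarith)] at h
  have h1 := one_le_boxCount hA hne hε.1
  rw [Real.rpow_neg hε.1.le, ← Real.inv_rpow hε.1.le]
  rw [Real.le_rpow_iff_log_le (by linarith) (inv_pos.2 hε.1)]
  exact h.le

/-- The quotient of logarithms is at least `1 + log c / log (1 / ε)`. Settling for `1 / 2` absorbs
the constant `c` for small `ε`. -/
theorem boxDim_pos {A : Set (EuclideanSpace ℝ (Fin d))} (hA : IsCompact A)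
    (hne : A.Nonempty) {c : ℝ} (hc : 0 < c) (h : ∀ ε > 0, c / ε ≤ boxCount A ε) :
    0 < boxDim A := by
  refine lt_of_lt_of_le one_half_pos
    (le_limsup_of_frequently_le (Eventually.frequently ?_) (isBoundedUnder_boxDim hA hne))
  filter_upwards [eventually_pos_lt one_pos, tendsto_log_inv_nhdsGT.eventually_ge_atTop 1,
    tendsto_log_inv_nhdsGT.eventually_ge_atTop (2 * |Real.log c|)] with ε hε hlog hlog2
  rw [le_div_iff₀ (by linarith)]
  refine le_trans ?_ (Real.log_le_log (div_pos hc hε.1) (h ε hε.1))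
  rw [div_eq_mul_inv c, Real.log_mul hc.ne' (inv_pos.2 hε.1).ne']
  have := neg_abs_le (Real.log c)
  linarith

/-- If every neighbourhood of `A` contains a connected set of diameter at least `ρ`, then the
number of `ε`-balls needed to cover `A` is at least of order `1 / ε`. -/
theorem div_le_boxCount {A : Set (EuclideanSpace ℝ (Fin d))} (hA : IsCompact A)
    (hne : A.Nonempty) {ρ : ℝ} (h : ∀ r > 0, ∃ K : Set (EuclideanSpace ℝ (Fin d)),
      IsPreconnected K ∧ (∀ x ∈ K, Metric.infDist x A ≤ r) ∧ ∃ p ∈ K, ∃ q ∈ K, ρ ≤ dist p q)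
    {ε : ℝ} (hε : 0 < ε) : ρ / 6 / ε ≤ boxCount A ε := by
  obtain ⟨N, x, -, hN, -, hcov⟩ := exists_cover hA hne hε
  refine le_trans ?_ hN
  obtain ⟨K, hK, hKA, p, hp, q, hq, hpq⟩ := h ε hε
  -- The distance to `p` maps the connected set `K` onto a set containing `[0, ρ]`. A point of `K`
  -- is within `ε` of `A`, hence within `3 * ε` of a centre, so `N` intervals of length `6 * ε`
  -- cover `[0, ρ]`; comparing lengths gives the bound.
  have hsub : Icc 0 ρ ⊆ ⋃ j ∈ Finset.range N,
      Icc (dist (x j) p - 3 * ε) (dist (x j) p + 3 * ε) := by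
    intro s hs
    have hpre := hK.image (fun y => dist y p) (by fun_prop)
    obtain ⟨y, hy, rfl⟩ := hpre.Icc_subset (mem_image_of_mem _ hp) (mem_image_of_mem _ hq)
      (show s ∈ Icc (dist p p) (dist q p) from
        ⟨by simpa using hs.1, hs.2.trans (hpq.trans_eq (dist_comm _ _))⟩)
    obtain ⟨a, ha, hya⟩ := hA.exists_infDist_eq_dist hne y
    obtain ⟨j, hj, haj⟩ := hcov a ha
    have h1 := hKA y hy
    rw [hya] at h1
    have h2 := dist_triangle y a (x j)
    have h3 := dist_triangle y (x j) p
    have h4 := dist_triangle (x j) y p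
    rw [dist_comm (x j) y] at h4
    refine mem_iUnion₂.2 ⟨j, Finset.mem_range.2 hj, ?_, ?_⟩ <;> linarith
  have hvol := (MeasureTheory.measure_mono (μ := MeasureTheory.volume) hsub).trans
    (MeasureTheory.measure_biUnion_finset_le _ _)
  simp only [Real.volume_Icc] at hvol
  rw [← ENNReal.ofReal_sum_of_nonneg (fun j _ => by linarith),
    ENNReal.ofReal_le_ofReal_iff (Finset.sum_nonneg fun j _ => by linarith)] at hvol
  rw [div_le_iff₀ hε]
  have : ∑ j ∈ Finset.range N, (dist (x j) p + 3 * ε - (dist (x j) p - 3 * ε)) = N * (6 * ε) := by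
    rw [← Finset.card_range N, ← nsmul_eq_mul, Finset.card_range]
    rw [← Finset.card_range N, ← Finset.sum_const, Finset.card_range]
    exact Finset.sum_congr rfl fun j _ => by ring
  rw [this] at hvol
  linarith

/-! ### Expansion along an attractor -/

theorem iterate_mem_of_image_eq {E : Type*} {f : E → E} {A : Set E} (hfA : f '' A = A) {x : E}
    (hx : x ∈ A) (n : ℕ) : f^[n] x ∈ A :=
  MapsTo.iterate (fun _ hy => hfA ▸ mem_image_of_mem f hy) n hx

section Calculus

variable {E : Type*} [NormedAddCommGroup E]

theorem exists_infDist_le_subset [ProperSpace E] {A V : Set E} (hA : IsCompact A)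
    (hne : A.Nonempty) (hV : V ∈ 𝓝ˢ A) : ∃ r > 0, ∀ y, Metric.infDist y A ≤ r → y ∈ V := by
  obtain ⟨U, hU, hAU, hUV⟩ := mem_nhdsSet_iff_exists.1 hV
  obtain ⟨r, hr, h⟩ := hA.exists_cthickening_subset_open hU hAU
  refine ⟨r, hr, fun y hy => hUV (h ?_)⟩
  rw [Metric.mem_cthickening_iff, Metric.infDist] at *
  rw [← ENNReal.ofReal_toReal (Metric.infEDist_ne_top hne)]
  exact ENNReal.ofReal_le_ofReal hy

theorem isCompact_infDist_le [ProperSpace E] {A : Set E} (hA : IsCompact A) (hne : A.Nonempty)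
    (r : ℝ) : IsCompact {y | Metric.infDist y A ≤ r} := by
  refine Metric.isCompact_of_isClosed_isBounded
    (isClosed_le (Metric.continuous_infDist_pt A) continuous_const) ?_
  obtain ⟨R, hR⟩ := hA.isBounded.subset_closedBall 0
  refine (Metric.isBounded_closedBall (x := (0 : E)) (r := R + r)).subset fun y hy => ?_
  obtain ⟨a, ha, hya⟩ := hA.exists_infDist_eq_dist hne y
  have h1 := hR ha
  have h2 : Metric.infDist y A ≤ r := hy
  rw [Metric.mem_closedBall] at *
  linarith [dist_triangle y a 0]

variable [NormedSpace ℝ E]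

/-- A map of class `C¹` at the points of a compact set is uniformly differentiable there. -/
theorem exists_uniform_differentiability [ProperSpace E] {g : E → E} {A : Set E} (hA : IsCompact A)
    (hne : A.Nonempty) (hg : ∀ x ∈ A, ContDiffAt ℝ 1 g x) {η : ℝ} (hη : 0 < η) :
    ∃ ρ > 0, ∀ x ∈ A, ∀ y, ‖y - x‖ ≤ ρ → ‖g y - g x - fderiv ℝ g x (y - x)‖ ≤ η * ‖y - x‖ := by
  have hU : {x | ContDiffAt ℝ 1 g x} ∈ 𝓝ˢ A := by
    rw [mem_nhdsSet_iff_forall]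
    exact fun x hx => (hg x hx).eventually (by simp)
  obtain ⟨r, hr, hrU⟩ := exists_infDist_le_subset hA hne hU
  replace hrU : ∀ y, Metric.infDist y A ≤ r → ContDiffAt ℝ 1 g y := hrU
  have hcont : ContinuousOn (fderiv ℝ g) {y | Metric.infDist y A ≤ r} := fun y hy =>
    ((hrU y hy).continuousAt_fderiv (by simp)).continuousWithinAt
  have huc := (isCompact_infDist_le hA hne r).uniformContinuousOn_of_continuous hcont
  rw [Metric.uniformContinuousOn_iff] at huc
  obtain ⟨δ, hδ, huc⟩ := huc η hη
  refine ⟨min r (δ / 2), lt_min hr (by linarith), fun x hx y hy => ?_⟩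
  have hball : ∀ z ∈ Metric.closedBall x (min r (δ / 2)), Metric.infDist z A ≤ r := fun z hz =>
    (Metric.infDist_le_dist_of_mem hx).trans ((Metric.mem_closedBall.1 hz).trans (min_le_left _ _))
  refine (convex_closedBall x (min r (δ / 2))).norm_image_sub_le_of_norm_fderiv_le' (𝕜 := ℝ)
    (fun z hz => (hrU z (hball z hz)).differentiableAt (by simp)) (fun z hz => ?_) ?_ ?_
  · rw [← dist_eq_norm]
    refine (huc z (hball z hz) x (hball x ?_) ?_).le
    · exact Metric.mem_closedBall_self (by positivity)
    · have := (Metric.mem_closedBall.1 hz).trans (min_le_right _ _)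
      linarith
  · exact Metric.mem_closedBall_self (by positivity)
  · rwa [Metric.mem_closedBall, dist_eq_norm]

theorem contDiffAt_iterate {f : E → E} {A : Set E} (hfA : f '' A = A)
    (hf : ∀ x ∈ A, ContDiffAt ℝ 1 f x) (n : ℕ) : ∀ x ∈ A, ContDiffAt ℝ 1 f^[n] x := by
  induction n with
  | zero => exact fun x _ => contDiffAt_id
  | succ n ih =>
    intro x hx
    rw [Function.iterate_succ]
    exact (ih _ (hfA ▸ mem_image_of_mem f hx)).comp x (hf x hx)

theorem comp_fderiv_iterate {f : E → E} {A : Set E} (hfA : f '' A = A)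
    (hf : ∀ x ∈ A, ContDiffAt ℝ 1 f x) {P : E → E →L[ℝ] E}
    (hP : ∀ x ∈ A, P (f x) ∘L fderiv ℝ f x = fderiv ℝ f x ∘L P x) (n : ℕ) :
    ∀ x ∈ A, ∀ v, P (f^[n] x) (fderiv ℝ f^[n] x v) = fderiv ℝ f^[n] x (P x v) := by
  induction n with
  | zero => intro x _ v; simp
  | succ n ih =>
    intro x hx v
    have hfx : f x ∈ A := hfA ▸ mem_image_of_mem f hx
    have hd : fderiv ℝ f^[n + 1] x = fderiv ℝ f^[n] (f x) ∘L fderiv ℝ f x := by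
      rw [Function.iterate_succ]
      exact fderiv_comp x ((contDiffAt_iterate hfA hf n _ hfx).differentiableAt (by simp))
        ((hf x hx).differentiableAt (by simp))
    have h1 := DFunLike.congr_fun (hP x hx) v
    simp only [ContinuousLinearMap.comp_apply] at h1
    rw [hd, Function.iterate_succ_apply, ContinuousLinearMap.comp_apply, ih _ hfx, h1]
    rfl

/-- Cone estimate: nearby orbits whose difference is initially unstable separate. -/
theorem exists_separation {g : E → E} {A : Set E} (hgA : MapsTo g A A) {P : E → E →L[ℝ] E}
    {K η ρ : ℝ} (hK : 0 ≤ K) (hη : 0 ≤ η) (hηK : 8 * (1 + K) * η ≤ 1)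
    (hPK : ∀ x ∈ A, ‖P x‖ ≤ K) (hPP : ∀ x ∈ A, ∀ v, P x (P x v) = P x v)
    (hcomm : ∀ x ∈ A, ∀ v, P (g x) (fderiv ℝ g x v) = fderiv ℝ g x (P x v))
    (hs : ∀ x ∈ A, ∀ v, P x v = v → ‖fderiv ℝ g x v‖ ≤ 1 / 4 * ‖v‖)
    (hu : ∀ x ∈ A, ∀ v, P x v = 0 → ‖v‖ ≤ 1 / 4 * ‖fderiv ℝ g x v‖)
    (hdiff : ∀ x ∈ A, ∀ y, ‖y - x‖ ≤ ρ →
      ‖g y - g x - fderiv ℝ g x (y - x)‖ ≤ η * ‖y - x‖)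
    {x y : E} (hx : x ∈ A) (hxy : y ≠ x) (hP : P x (y - x) = 0) :
    ∃ n, ρ < ‖g^[n] y - g^[n] x‖ := by
  by_contra! hcon
  set D : ℕ → E := fun n => g^[n] y - g^[n] x with hD
  have hmem : ∀ n, g^[n] x ∈ A := fun n => hgA.iterate n hx
  -- The difference of the orbits stays in the unstable cone and its unstable part doubles. With
  -- `s`, `t` the stable and unstable parts and `‖s‖ ≤ ‖t‖`, the nonlinear error costs at most `‖t‖
  -- / 4` by the choice of `η`; the new stable part is then at most `‖t‖ / 2`, and the new unstable
  -- part at least `(4 - 1 / 4) * ‖t‖`.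
  have key : ∀ n, ‖P (g^[n] x) (D n)‖ ≤ ‖D n - P (g^[n] x) (D n)‖ ∧
      2 ^ n * ‖y - x‖ ≤ ‖D n - P (g^[n] x) (D n)‖ := by
    intro n
    induction n with
    | zero =>
      simp only [hD, Function.iterate_zero, id]
      rw [hP]; simp
    | succ n ih =>
      set X := g^[n] x with hX
      set s := P X (D n) with hsdef
      set t := D n - s with htdef
      have hXA : X ∈ A := hmem n
      set e := g (g^[n] y) - g X - fderiv ℝ g X (D n) with he
      have hDn : D (n + 1) = fderiv ℝ g X (D n) + e := by
        simp only [hD, Function.iterate_succ_apply', he, hX]; abel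
      have hen : ‖e‖ ≤ η * ‖D n‖ := hdiff X hXA _ (hcon n)
      have hDst : D n = s + t := by simp [htdef]
      have hDn2 : ‖D n‖ ≤ 2 * ‖t‖ := by
        rw [hDst]; exact (norm_add_le _ _).trans (by linarith [ih.1])
      have hPs : P X s = s := hPP X hXA _
      have hPt : P X t = 0 := by rw [htdef, map_sub, hPs, ← hsdef, sub_self]
      have hgX : g^[n + 1] x = g X := Function.iterate_succ_apply' g n x
      have hPe : ‖P (g X) e‖ ≤ K * ‖e‖ :=
        ((P (g X)).le_opNorm e).trans
          (mul_le_mul_of_nonneg_right (hPK _ (hgA hXA)) (norm_nonneg _))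
      have hPD : P (g X) (D (n + 1)) = fderiv ℝ g X s + P (g X) e := by
        rw [hDn, map_add, hcomm X hXA]
      have hQD : D (n + 1) - P (g X) (D (n + 1)) = fderiv ℝ g X t + (e - P (g X) e) := by
        rw [hPD, hDn]
        conv_lhs => rw [hDst, map_add]
        abel
      have h1 := hs X hXA s hPs
      have h2 := hu X hXA t hPt
      have hKe : (1 + K) * ‖e‖ ≤ 1 / 4 * ‖t‖ := by
        have h5 : (1 + K) * ‖e‖ ≤ (1 + K) * (η * (2 * ‖t‖)) :=
          mul_le_mul_of_nonneg_left
            (hen.trans (mul_le_mul_of_nonneg_left hDn2 hη)) (by positivity)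
        nlinarith [norm_nonneg t]
      have h3 : ‖P (g X) (D (n + 1))‖ ≤ 1 / 2 * ‖t‖ := by
        rw [hPD]
        refine (norm_add_le _ _).trans ?_
        have := norm_nonneg e
        linarith [ih.1]
      have h4 : 2 * ‖t‖ ≤ ‖D (n + 1) - P (g X) (D (n + 1))‖ := by
        rw [hQD]
        have h6 := norm_sub_norm_le (fderiv ℝ g X t) (-(e - P (g X) e))
        rw [sub_neg_eq_add, norm_neg] at h6
        have h7 := norm_sub_le e (P (g X) e)
        have := norm_nonneg t
        linarith
      rw [hgX]
      refine ⟨by linarith [norm_nonneg t], ?_⟩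
      rw [pow_succ]
      linarith [ih.2]
  have hpos : 0 < ‖y - x‖ := norm_pos_iff.2 (sub_ne_zero.2 hxy)
  obtain ⟨n, hn⟩ := pow_unbounded_of_one_lt ((1 + K) * ρ / ‖y - x‖) (one_lt_two (α := ℝ))
  rw [div_lt_iff₀ hpos] at hn
  have h1 := (key n).2
  have h2 : ‖D n - P (g^[n] x) (D n)‖ ≤ (1 + K) * ‖D n‖ := by
    refine (norm_sub_le _ _).trans ?_
    have := ((P (g^[n] x)).le_opNorm (D n)).trans
      (mul_le_mul_of_nonneg_right (hPK _ (hmem n)) (norm_nonneg _))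
    linarith
  have h3 : (1 + K) * ‖D n‖ ≤ (1 + K) * ρ :=
    mul_le_mul_of_nonneg_left (hcon n) (by positivity)
  linarith

end Calculus

/-- Since `g^j(A) = A`, the images under `g^j` of one fixed finite `ρ`-net form a `ρ / 2 ^ j`-net of
`A`, and the number of its points does not grow with `j`. -/
theorem exists_boxCount_le_const {g : EuclideanSpace ℝ (Fin d) → EuclideanSpace ℝ (Fin d)}
    {A : Set (EuclideanSpace ℝ (Fin d))} (hA : IsCompact A) (hgA : g '' A = A)
    {ρ : ℝ} (hρ : 0 < ρ)
    (h : ∀ x ∈ A, ∀ y, ‖y - x‖ ≤ ρ → ‖g y - g x‖ ≤ 1 / 2 * ‖y - x‖) :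
    ∃ N₀ : ℝ, ∀ ε > 0, boxCount A ε ≤ N₀ := by
  classical
  obtain ⟨t, htA, ht, hAt⟩ := hA.finite_cover_balls hρ
  have key : ∀ j : ℕ, ∀ a ∈ A, ∃ c ∈ t, ‖a - g^[j] c‖ ≤ ρ * (1 / 2) ^ j := by
    intro j
    induction j with
    | zero =>
      intro a ha
      obtain ⟨c, hc, hac⟩ := mem_iUnion₂.1 (hAt ha)
      exact ⟨c, hc, by simpa [dist_eq_norm] using (Metric.mem_ball.1 hac).le⟩
    | succ j ih =>
      intro a ha
      rw [← hgA] at ha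
      obtain ⟨a, ha, rfl⟩ := ha
      obtain ⟨c, hc, hac⟩ := ih a ha
      refine ⟨c, hc, ?_⟩
      rw [Function.iterate_succ_apply']
      have hle : ρ * (1 / 2) ^ j ≤ ρ :=
        mul_le_of_le_one_right hρ.le (pow_le_one₀ (by norm_num) (by norm_num))
      refine (h _ (iterate_mem_of_image_eq hgA (htA hc) j) a (hac.trans hle)).trans ?_
      rw [pow_succ]
      linarith
  refine ⟨ht.toFinset.card, fun ε hε => ?_⟩
  obtain ⟨j, hj⟩ := exists_pow_lt_of_lt_one (div_pos hε hρ) (by norm_num : (1 / 2 : ℝ) < 1)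
  rw [lt_div_iff₀ hρ] at hj
  refine (boxCount_le_of_finset (ht.toFinset.image g^[j]) fun a ha => ?_).trans
    (by exact_mod_cast Finset.card_image_le)
  obtain ⟨c, hc, hac⟩ := key j a ha
  refine ⟨g^[j] c, Finset.mem_image_of_mem _ (by simpa using hc), ?_⟩
  rw [dist_eq_norm]
  linarith

/-- On a uniformly hyperbolic attractor, either all directions are contracted, and the covering
numbers are bounded, or the dimension is positive. -/
theorem boxCount_bounded_or_boxDim_pos
    {f : EuclideanSpace ℝ (Fin d) → EuclideanSpace ℝ (Fin d)}
    {A V : Set (EuclideanSpace ℝ (Fin d))} (hA : IsCompact A) (hne : A.Nonempty)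
    (hfA : f '' A = A) (hAV : V ∈ 𝓝ˢ A) (hf : ∀ x ∈ V, ContDiffAt ℝ 1 f x)
    (hhyp : UniformlyHyperbolicOn f V) {lm : ℝ} (hlm : lm < 0)
    (hcontr : ∀ y ∈ V, Metric.infDist (f y) A ≤ Real.exp lm * Metric.infDist y A) :
    (∃ N₀ : ℝ, ∀ ε > 0, boxCount A ε ≤ N₀) ∨ 0 < boxDim A := by
  obtain ⟨P, c, μ, hc, hμ0, hμ1, hPc, hPP, hcomm, hest⟩ := hhyp
  have hAV' : A ⊆ V := subset_of_mem_nhdsSet hAV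
  have hfm : ∀ x ∈ A, f x ∈ A := fun x hx => hfA ▸ mem_image_of_mem f hx
  have hfA1 : ∀ x ∈ A, ContDiffAt ℝ 1 f x := fun x hx => hf x (hAV' hx)
  -- Passing to the iterate `f^[m]` removes the constant `c`: both rates become at most `1 / 4`.
  obtain ⟨m, hm⟩ := exists_pow_lt_of_lt_one (show 0 < 1 / (4 * c) by positivity) hμ1
  have hcm : c * μ ^ m ≤ 1 / 4 := by
    rw [lt_div_iff₀ (by positivity)] at hm
    linarith
  have hgA : f^[m] '' A = A := by
    clear hm hcm
    induction m with
    | zero => simp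
    | succ m ih => rw [Function.iterate_succ, image_comp, hfA, ih]
  have hg1 := contDiffAt_iterate hfA hfA1 m
  have hs : ∀ x ∈ A, ∀ v, P x v = v → ‖fderiv ℝ f^[m] x v‖ ≤ 1 / 4 * ‖v‖ := fun x hx v hv =>
    ((hest x m fun i _ => hAV' (iterate_mem_of_image_eq hfA hx i)).1 v hv).trans
      (mul_le_mul_of_nonneg_right hcm (norm_nonneg _))
  have hu : ∀ x ∈ A, ∀ v, P x v = 0 → ‖v‖ ≤ 1 / 4 * ‖fderiv ℝ f^[m] x v‖ := fun x hx v hv =>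
    ((hest x m fun i _ => hAV' (iterate_mem_of_image_eq hfA hx i)).2 v hv).trans
      (mul_le_mul_of_nonneg_right hcm (norm_nonneg _))
  -- In the first case there are no unstable directions over `A`, and `f^[m]` contracts distances to
  -- points of `A` by `1 / 4 + 1 / 4`.
  by_cases hid : ∀ x ∈ A, ∀ v, P x v = v
  · left
    obtain ⟨ρ, hρ, hdiff⟩ := exists_uniform_differentiability hA hne hg1
      (show (0 : ℝ) < 1 / 4 by norm_num)
    refine exists_boxCount_le_const hA hgA hρ fun x hx y hy => ?_
    have h1 := hdiff x hx y hy
    have h2 := hs x hx (y - x) (hid x hx _)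
    have h3 := norm_add_le (f^[m] y - f^[m] x - fderiv ℝ f^[m] x (y - x))
      (fderiv ℝ f^[m] x (y - x))
    rw [sub_add_cancel] at h3
    linarith
  · right
    push Not at hid
    obtain ⟨x, hx, v, hv⟩ := hid
    obtain ⟨K', hK'⟩ := hA.exists_bound_of_continuousOn (hPc.mono hAV')
    set K := max K' 0 with hKdef
    have hK0 : 0 ≤ K := le_max_right _ _
    have hη : 0 < 1 / (8 * (1 + K)) := by positivity
    obtain ⟨ρ, hρ, hdiff⟩ := exists_uniform_differentiability hA hne hg1 hη
    obtain ⟨r₀, hr₀, hr₀V⟩ := exists_infDist_le_subset hA hne hAV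
    refine boxDim_pos hA hne (c := ρ / 6) (by positivity) fun ε hε =>
      div_le_boxCount hA hne (fun r hr => ?_) hε
    set w := v - P x v with hw
    have hw0 : w ≠ 0 := sub_ne_zero.2 (Ne.symm hv)
    have hPP' : ∀ x ∈ A, ∀ v, P x (P x v) = P x v := fun x hx v =>
      DFunLike.congr_fun (hPP x (hAV' hx)) v
    have hPw : P x w = 0 := by rw [hw, map_sub, hPP' x hx, sub_self]
    have hwn : 0 < ‖w‖ := norm_pos_iff.2 hw0
    set r' := min r r₀ with hr'
    have hr'0 : 0 < r' := lt_min hr hr₀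
    -- A point at distance `r'` from `x` in an unstable direction. The scale `ρ` at which the two
    -- orbits separate is independent of `r`.
    set y := x + (r' / ‖w‖) • w with hy
    have hyx : y - x = (r' / ‖w‖) • w := by simp [hy]
    have hyx_norm : ‖y - x‖ = r' := by
      rw [hyx, norm_smul, Real.norm_eq_abs, abs_of_pos (by positivity)]
      field_simp
    obtain ⟨n, hn⟩ := exists_separation (g := f^[m]) (A := A) (P := P) (K := K)
      (fun z hz => iterate_mem_of_image_eq hfA hz m) hK0 hη.le
      (by rw [mul_one_div, div_self (by positivity)])
      (fun z hz => (hK' z hz).trans (le_max_left _ _)) hPP'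
      (comp_fderiv_iterate hfA hfA1
        (fun z hz => hcomm z (hAV' hz) (hAV' (hfm z hz))) m)
      hs hu hdiff hx (y := y) (by
        rintro h; rw [h, sub_self, norm_zero] at hyx_norm; linarith) (by rw [hyx, map_smul, hPw, smul_zero])
    rw [← Function.iterate_mul] at hn
    -- Images of the segment remain connected and within `r'` of `A`, since `f` does not increase
    -- the distance to `A` on `V`. The image in which the endpoints are separated by `ρ` is the set
    -- required by `div_le_boxCount`.
    have hseg : ∀ i, (∀ z ∈ f^[i] '' segment ℝ x y, Metric.infDist z A ≤ r') ∧
        IsPreconnected (f^[i] '' segment ℝ x y) := by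
      intro i
      induction i with
      | zero =>
        simp only [Function.iterate_zero, image_id]
        refine ⟨fun z hz => ?_, (convex_segment x y).isPreconnected⟩
        refine (Metric.infDist_le_dist_of_mem hx).trans ?_
        rw [dist_eq_norm, ← hyx_norm]
        exact norm_sub_le_of_mem_segment hz
      | succ i ih =>
        rw [Function.iterate_succ', image_comp]
        have hV : ∀ z ∈ f^[i] '' segment ℝ x y, z ∈ V := fun z hz =>
          hr₀V z ((ih.1 z hz).trans (min_le_right _ _))
        refine ⟨?_, ih.2.image f fun z hz => (hf z (hV z hz)).continuousAt.continuousWithinAt⟩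
        rintro _ ⟨z, hz, rfl⟩
        refine (hcontr z (hV z hz)).trans (le_trans ?_ (ih.1 z hz))
        exact mul_le_of_le_one_left Metric.infDist_nonneg (Real.exp_le_one_iff.2 hlm.le)
    refine ⟨_, (hseg (m * n)).2, fun z hz => ((hseg (m * n)).1 z hz).trans (min_le_left _ _),
      _, mem_image_of_mem _ (left_mem_segment ℝ x y), _,
      mem_image_of_mem _ (right_mem_segment ℝ x y), ?_⟩
    rw [dist_comm, dist_eq_norm]
    exact hn.le

/-! ### Pseudo-orbits near an attractor -/

section PseudoOrbit

variable {E : Type*} [NormedAddCommGroup E] {f : E → E} {A : Set E} {p q R τ r : ℝ} {z : ℕ → E}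

/-- The distance to `A` obeys `eᵢ₊₁ ≤ p eᵢ + τ`, which sums to the second bound. The first bound,
from `p R + τ ≤ R`, must be carried along, because the contraction and the bound on the jumps are
available only in the `R`-neighbourhood. -/
theorem infDist_pseudoOrbit_le (hp0 : 0 ≤ p) (hp : p < 1) (hR : R ≤ r) (hτ : τ ≤ (1 - p) * R)
    (hcontr : ∀ y, Metric.infDist y A ≤ r → Metric.infDist (f y) A ≤ p * Metric.infDist y A)
    (hz0 : Metric.infDist (z 0) A ≤ R)
    (hz : ∀ i, Metric.infDist (z i) A ≤ R → ‖z (i + 1) - f (z i)‖ ≤ τ) (i : ℕ) :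
    Metric.infDist (z i) A ≤ R ∧
      Metric.infDist (z i) A ≤ p ^ i * R + τ / (1 - p) * (1 - p ^ i) := by
  have h1p : 0 < 1 - p := by linarith
  induction i with
  | zero => simpa using hz0
  | succ i ih =>
    have h1 : Metric.infDist (z (i + 1)) A ≤ p * Metric.infDist (z i) A + τ := by
      refine (Metric.infDist_le_infDist_add_dist (y := f (z i))).trans ?_
      rw [dist_eq_norm]
      exact add_le_add (hcontr _ (ih.1.trans hR)) (hz i ih.1)
    constructor
    · nlinarith [ih.1]
    · refine h1.trans ?_
      have h2 := mul_le_mul_of_nonneg_left ih.2 hp0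
      have h3 : τ / (1 - p) * (1 - p) = τ := div_mul_cancel₀ _ h1p.ne'
      rw [pow_succ]
      nlinarith

/-- The deviation from a true orbit in `A` obeys `eᵢ₊₁ ≤ q eᵢ + τ` as long as it is at most `r`; the
hypothesis `hn` ensures this up to time `n`. -/
theorem norm_pseudoOrbit_sub_le (hp0 : 0 ≤ p) (hp : p < 1) (hq : 1 < q) (hτ0 : 0 ≤ τ)
    (hR : R ≤ r) (hτ : τ ≤ (1 - p) * R)
    (hcontr : ∀ y, Metric.infDist y A ≤ r → Metric.infDist (f y) A ≤ p * Metric.infDist y A)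
    (hfA : f '' A = A)
    (hexp : ∀ a ∈ A, ∀ y, ‖y - a‖ ≤ r → ‖f y - f a‖ ≤ q * ‖y - a‖)
    (hz0 : Metric.infDist (z 0) A ≤ R)
    (hz : ∀ i, Metric.infDist (z i) A ≤ R → ‖z (i + 1) - f (z i)‖ ≤ τ)
    {b : E} (hb : b ∈ A) (hzb : ‖z 0 - b‖ ≤ τ) {n : ℕ}
    (hn : (1 + 1 / (q - 1)) * q ^ n * τ ≤ r) :
    ‖z n - f^[n] b‖ ≤ (1 + 1 / (q - 1)) * q ^ n * τ := by
  have hq1 : 0 < q - 1 := by linarith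
  -- The right-hand side is the exact solution of `eᵢ₊₁ = q eᵢ + τ`, `e₀ = τ`.
  have key : ∀ i ≤ n, ‖z i - f^[i] b‖ ≤ (1 + 1 / (q - 1)) * q ^ i * τ - τ / (q - 1) := by
    intro i
    induction i with
    | zero =>
      intro _
      simp only [Function.iterate_zero, id]
      refine hzb.trans (le_of_eq ?_)
      ring
    | succ i ih =>
      intro hi
      have h1 := ih (by omega)
      have h2 : ‖z i - f^[i] b‖ ≤ r := by
        refine h1.trans (le_trans ?_ hn)
        have h3 : q ^ i ≤ q ^ n := pow_le_pow_right₀ hq.le (by omega)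
        have h4 : 0 ≤ τ / (q - 1) := by positivity
        have h5 : (1 + 1 / (q - 1)) * q ^ i * τ ≤ (1 + 1 / (q - 1)) * q ^ n * τ := by gcongr
        linarith
      have h3 := hexp _ (iterate_mem_of_image_eq hfA hb i) _ h2
      have h4 := hz i (infDist_pseudoOrbit_le hp0 hp hR hτ hcontr hz0 hz i).1
      have h5 : z (i + 1) - f^[i + 1] b = (z (i + 1) - f (z i)) + (f (z i) - f (f^[i] b)) := by
        rw [Function.iterate_succ_apply']; abel
      rw [h5]
      refine (norm_add_le _ _).trans ((add_le_add h4
        (h3.trans (mul_le_mul_of_nonneg_left h1 (by linarith)))).trans (le_of_eq ?_))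
      field_simp
      ring
  refine (key n le_rfl).trans ?_
  have h4 : 0 ≤ τ / (q - 1) := by positivity
  linarith

end PseudoOrbit

/-! ### Fixed point arithmetic -/

theorem monom_nonneg {h : EuclideanSpace ℝ (Fin d)} (h0 : ∀ i, 0 ≤ h i) (w : Word d k) :
    0 ≤ monom h w := by
  refine Finset.prod_nonneg fun t _ => ?_
  refine Fin.cases ?_ (fun i => ?_) (w t)
  · simp
  · simpa using h0 i

theorem monom_le_one {h : EuclideanSpace ℝ (Fin d)} (h0 : ∀ i, 0 ≤ h i) (h1 : ∀ i, h i ≤ 1)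
    (w : Word d k) : monom h w ≤ 1 := by
  refine Finset.prod_le_one (fun t _ => ?_) fun t _ => ?_
  · refine Fin.cases ?_ (fun i => ?_) (w t)
    · simp
    · simpa using h0 i
  · refine Fin.cases ?_ (fun i => ?_) (w t)
    · simp
    · simpa using h1 i

/-- As the letter `0` has the value `Q`, every word contributes exactly `Q ^ k` times its monomial,
so integer arithmetic is exact up to a single final division. Rounding costs at most `1` for each of
the `(d + 1) ^ k` words, since the monomials are at most `1`, and `1` for the division. The
hypothesis `hpos` guarantees that the truncated subtraction does not truncate. -/
theorem abs_polyMap_sub_le {κ Q : ℕ} (hQ : 0 < Q) {c y : Fin d → ℕ} (hcy : ∀ i, c i ≤ y i)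
    {h : EuclideanSpace ℝ (Fin d)} (hh : ∀ i, h i = ((y i : ℝ) - c i) / Q) (h1 : ∀ i, h i ≤ 1)
    {a : Fin d → Word d k → ℝ} (ha : ∀ i w, |a i w| ≤ κ) (i : Fin d)
    (hpos : ((d : ℝ) + 1) ^ k ≤ Q * ∑ w, a i w * monom h w) :
    |(polyMap κ Q c (fun i w => ⌊(a i w + κ) * Q⌋₊) y i : ℝ) / Q - ∑ w, a i w * monom h w|
      ≤ (((d : ℝ) + 1) ^ k + 1) / Q := by
  have hQ' : (0 : ℝ) < Q := by exact_mod_cast hQ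
  have h0 : ∀ i, 0 ≤ h i := fun i => by
    rw [hh]
    have : (c i : ℝ) ≤ y i := by exact_mod_cast hcy i
    exact div_nonneg (by linarith) hQ'.le
  set H : Word d k → ℕ := fun w => ∏ t, (Fin.cons Q (fun l => y l - c l) : Fin (d + 1) → ℕ) (w t)
    with hH
  have hHm : ∀ w, (H w : ℝ) = Q ^ k * monom h w := by
    intro w
    have : (Q : ℝ) ^ k = ∏ _t : Fin k, (Q : ℝ) := by simp
    rw [hH, monom, this, ← Finset.prod_mul_distrib]
    push_cast
    refine Finset.prod_congr rfl fun t _ => ?_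
    refine Fin.cases ?_ (fun i => ?_) (w t)
    · simp
    · simp only [Fin.cons_succ]
      rw [Nat.cast_sub (hcy i), hh]
      field_simp
  set X := ∑ w, ⌊(a i w + κ) * Q⌋₊ * H w with hX
  set Y := κ * Q * ∑ w, H w with hY
  set T : ℝ := ∑ w, ((⌊(a i w + κ) * Q⌋₊ : ℝ) - κ * Q) * monom h w with hT
  have hXY : (X : ℝ) - Y = Q ^ k * T := by
    rw [hX, hY, hT]
    push_cast
    simp_rw [hHm, Finset.mul_sum]
    rw [← Finset.sum_sub_distrib]
    exact Finset.sum_congr rfl fun w _ => by ring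
  have hTp : |T - Q * ∑ w, a i w * monom h w| ≤ ((d : ℝ) + 1) ^ k := by
    rw [hT, Finset.mul_sum, ← Finset.sum_sub_distrib]
    refine (Finset.abs_sum_le_sum_abs _ _).trans ?_
    have : ∑ _w : Word d k, (1 : ℝ) = ((d : ℝ) + 1) ^ k := by simp
    rw [← this]
    refine Finset.sum_le_sum fun w _ => ?_
    have hnn : 0 ≤ (a i w + κ) * Q :=
      mul_nonneg (by linarith [(abs_le.1 (ha i w)).1]) hQ'.le
    have e : ((⌊(a i w + κ) * Q⌋₊ : ℝ) - κ * Q) * monom h w - Q * (a i w * monom h w)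
        = ((⌊(a i w + κ) * Q⌋₊ : ℝ) - (a i w + κ) * Q) * monom h w := by ring
    rw [e, abs_mul, abs_of_nonneg (monom_nonneg h0 w)]
    refine mul_le_one₀ ?_ (monom_nonneg h0 w) (monom_le_one h0 h1 w)
    have h2 := Nat.floor_le hnn
    have h3 := Nat.lt_floor_add_one ((a i w + κ) * Q)
    rw [abs_le]; constructor <;> linarith
  have hT0 : 0 ≤ T := by have := (abs_le.1 hTp).1; linarith
  have hle : Y ≤ X := by
    have : (0 : ℝ) ≤ X - Y := by rw [hXY]; positivity
    exact_mod_cast (by linarith : (Y : ℝ) ≤ X)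
  have hval : polyMap κ Q c (fun i w => ⌊(a i w + κ) * Q⌋₊) y i = ⌊T⌋₊ := by
    have : T = ((X - Y : ℕ) : ℝ) / ((Q ^ k : ℕ) : ℝ) := by
      rw [Nat.cast_sub hle, hXY]; push_cast; field_simp
    rw [this, Nat.floor_div_eq_div]
    rfl
  rw [hval]
  have h2 := Nat.floor_le hT0
  have h3 := Nat.lt_floor_add_one T
  have e : (⌊T⌋₊ : ℝ) / Q - ∑ w, a i w * monom h w
      = ((⌊T⌋₊ : ℝ) - Q * ∑ w, a i w * monom h w) / Q := by field_simp
  rw [e, abs_div, abs_of_pos hQ', div_le_div_iff_of_pos_right hQ']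
  have h4 := abs_le.1 hTp
  rw [abs_le]; constructor <;> linarith [h4.1, h4.2]

theorem cellIndex_spec {N s : ℕ} {c : ℕ → Fin d → ℕ} {y : Fin d → ℕ}
    (h : ∃ j < N, ∀ i, c j i ≤ y i ∧ y i ≤ c j i + s) :
    cellIndex N s c y < N ∧ ∀ i, c (cellIndex N s c y) i ≤ y i ∧
      y i ≤ c (cellIndex N s c y) i + s := by
  obtain ⟨j, hj, hjy⟩ := h
  have hlt : cellIndex N s c y < (List.range N).length :=
    List.findIdx_lt_length_of_exists ⟨j, List.mem_range.2 hj, by simpa using hjy⟩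
  have h1 := of_decide_eq_true (List.findIdx_getElem (w := hlt))
  have h2 : (List.range N)[cellIndex N s c y]'hlt = cellIndex N s c y := List.getElem_range hlt
  refine ⟨by simpa using hlt, fun i => ?_⟩
  rw [← h2]
  exact h1 i

theorem abs_gridPoint_floor_sub_le {σ Q : ℕ} (hQ : 0 < Q) {t : ℝ} (ht : 0 ≤ t + σ) :
    |(⌊(t + σ) * Q⌋₊ : ℝ) / Q - σ - t| ≤ 1 / Q := by
  have hQ' : (0 : ℝ) < Q := by exact_mod_cast hQ
  have h2 := Nat.floor_le (mul_nonneg ht hQ'.le)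
  have h3 := Nat.lt_floor_add_one ((t + σ) * Q)
  have e : (⌊(t + σ) * Q⌋₊ : ℝ) / Q - σ - t = ((⌊(t + σ) * Q⌋₊ : ℝ) - (t + σ) * Q) / Q := by
    field_simp; ring
  rw [e, abs_div, abs_of_pos hQ', div_le_div_iff_of_pos_right hQ', abs_le]
  constructor <;> linarith

/-! ### Piecewise polynomial description of a map near an attractor -/

theorem eventually_mul_le (D : ℝ) {c : ℝ} (hc : 0 < c) : ∀ᶠ δ : ℝ in 𝓝[>] 0, D * δ ≤ c := by
  have h : Tendsto (fun δ : ℝ => D * δ) (𝓝[>] 0) (𝓝 (D * 0)) :=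
    (tendsto_id.const_mul D).mono_left nhdsWithin_le_nhds
  rw [mul_zero] at h
  exact h.eventually_le_const hc

theorem exists_abs_coord_le {A : Set (EuclideanSpace ℝ (Fin d))} (hA : IsCompact A) :
    ∃ σ : ℕ, ∀ a ∈ A, ∀ i, |a i| + 2 ≤ σ := by
  obtain ⟨ρ, hρ⟩ := hA.isBounded.subset_closedBall 0
  refine ⟨⌈ρ⌉₊ + 2, fun a ha i => ?_⟩
  have h1 : ‖a‖ ≤ ρ := by simpa using hρ ha
  have h2 := PiLp.norm_apply_le a i
  rw [Real.norm_eq_abs] at h2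
  have h3 := Nat.le_ceil ρ
  push_cast
  linarith

set_option maxHeartbeats 1000000 in
/-- The map `f` is approximated near `A` by piecewise polynomial maps in fixed point
arithmetic. -/
theorem exists_cells {f : EuclideanSpace ℝ (Fin d) → EuclideanSpace ℝ (Fin d)}
    {A W : Set (EuclideanSpace ℝ (Fin d))} (hA : IsCompact A) (hne : A.Nonempty)
    (hk : 1 ≤ k) (hW : IsOpen W) (hf : ContDiffOn ℝ k f W) {r : ℝ} (hr : 0 < r)
    (hrW : ∀ y, Metric.infDist y A ≤ r → y ∈ W)
    (hcontr : ∀ y, Metric.infDist y A ≤ r → Metric.infDist (f y) A ≤ Metric.infDist y A) :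
    ∃ (σ κ : ℕ) (C δ₀ : ℝ), 0 < C ∧ 0 < δ₀ ∧ ∀ δ, 0 < δ → δ < δ₀ → ∀ Q : ℕ, 2 ≤ δ * Q →
      1 ≤ δ ^ k * Q → ∀ (N : ℕ) (x : ℕ → EuclideanSpace ℝ (Fin d)), (∀ j < N, x j ∈ A) →
      (∀ a ∈ A, ∃ j < N, dist a (x j) ≤ δ) →
      ∃ (u : ℕ) (c : ℕ → Fin d → ℕ) (a : ℕ → Fin d → Word d k → ℕ),
        (u : ℝ) ≤ Q ∧ (∀ j < N, ∀ i, (c j i : ℝ) ≤ C * Q) ∧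
        (∀ j < N, ∀ i w, (a j i w : ℝ) ≤ C * Q) ∧
        ∀ (c' : ℕ → Fin d → ℕ) (a' : ℕ → Fin d → Word d k → ℕ),
          (∀ j < N, c' j = c j ∧ a' j = a j) →
          (∀ y, Metric.infDist (gridPoint σ Q y) A ≤ 2 * d * δ →
            ‖gridPoint σ Q (cellMap κ N (2 * (2 * d + 2) * u) Q c' a' y) - f (gridPoint σ Q y)‖
              ≤ C * δ ^ k) ∧
          (∀ j < N, ∀ o : Fin d → ℕ, (∀ i, o i < 2 * u + 1) →
            Metric.infDist (gridPoint σ Q fun i => c' j i + (2 * d + 1) * u + o i) A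
              ≤ 2 * d * δ) ∧
          ∀ b ∈ A, ∃ j < N, ∃ o : Fin d → ℕ, (∀ i, o i < 2 * u + 1) ∧
            ‖(gridPoint σ Q fun i => c' j i + (2 * d + 1) * u + o i) - b‖ ≤ d / Q := by
  obtain ⟨σ, hσ⟩ := exists_abs_coord_le hA
  -- The polynomials approximate the shifted coordinates, which are positive near `A`, so that
  -- natural numbers suffice.
  have hcoord : ∀ i : Fin d, ContDiffOn ℝ k (fun y => f y i + σ) W := fun i =>
    (contDiffOn_euclidean.1 hf i).add contDiffOn_const
  choose Ci hCi0 hCi using fun i => exists_poly_approx k _ W _ hW (hcoord i)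
    (isCompact_infDist_le hA hne r) hrW
  set C₀ := ∑ i, Ci i with hC₀
  have hC₀0 : 0 ≤ C₀ := Finset.sum_nonneg fun i _ => hCi0 i
  have hCi_le : ∀ i, Ci i ≤ C₀ := fun i =>
    Finset.single_le_sum (fun j _ => hCi0 j) (Finset.mem_univ i)
  set κ := ⌈C₀⌉₊ with hκ
  have hκ1 : C₀ ≤ κ := Nat.le_ceil _
  set D : ℝ := d * (8 * d + 8) with hD
  have hD0 : 0 ≤ D := by positivity
  set ν : ℝ := ((d : ℝ) + 1) ^ k with hν
  have hν0 : 0 ≤ ν := by positivity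
  -- In order: corners lie within `r / 2` of the centres; offsets in a cell have norm at most `r /
  -- 2`, and coordinates at most `1`; the `2 * d * δ`-neighbourhood of `A` lies in the
  -- `r`-neighbourhood and in the `1 / 2`-neighbourhood; the polynomial error is at most `1 / 2`; `ν
  -- ≤ Q`; `δ ≤ 1`.
  obtain ⟨δ₀, hδ₀, hsmall⟩ := mem_nhdsGT_iff_exists_Ioo_subset.1
    ((eventually_mul_le (d * (4 * d + 5)) (half_pos hr)).and
    ((eventually_mul_le D (half_pos hr)).and
    ((eventually_mul_le (8 * d + 8) one_pos).and
    ((eventually_mul_le (2 * d) hr).and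
    ((eventually_mul_le (2 * d) one_half_pos).and
    ((eventually_mul_le (C₀ * D ^ k) one_half_pos).and
    ((eventually_mul_le ν two_pos).and (eventually_mul_le 1 one_pos))))))))
  refine ⟨σ, κ, d * (ν + 1 + C₀ * D ^ k) + 2 * σ + 2 * κ + 1, δ₀, by positivity, hδ₀, ?_⟩
  intro δ hδ hδ' Q hQ2 hQk N x hxA hcov
  obtain ⟨s1, s2, s3, s4, s5, s6, s7, s8⟩ := hsmall ⟨hδ, hδ'⟩
  rw [one_mul] at s8
  have hd0 : (0 : ℝ) ≤ d := Nat.cast_nonneg d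
  have hQ' : (0 : ℝ) < Q := by
    by_contra hcon
    have : (Q : ℝ) = 0 := le_antisymm (not_lt.1 hcon) (Nat.cast_nonneg Q)
    rw [this] at hQ2; norm_num at hQ2
  have hQ : 0 < Q := by exact_mod_cast hQ'
  have hQ1 : (1 : ℝ) ≤ Q := by exact_mod_cast hQ
  have hδk : δ ^ k ≤ δ := by
    calc δ ^ k ≤ δ ^ 1 := pow_le_pow_of_le_one hδ.le s8 hk
      _ = δ := pow_one δ
  set u := ⌈δ * Q⌉₊ with hu
  have hu1 : δ * Q ≤ u := Nat.le_ceil _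
  have hu2 : (u : ℝ) ≤ δ * Q + 1 := (Nat.ceil_lt_add_one (by positivity)).le
  have hu3 : (u : ℝ) ≤ 2 * (δ * Q) := by linarith
  set X : ℕ → Fin d → ℕ := fun j i => ⌊(x j i + σ) * Q⌋₊ with hX
  have hxσ : ∀ j < N, ∀ i, 2 ≤ x j i + σ ∧ x j i + σ ≤ 2 * σ := by
    intro j hj i
    have h1 := hσ _ (hxA j hj) i
    have h2 := abs_le.1 (le_refl |x j i|)
    constructor <;> linarith [h2.1, h2.2]
  have hXle : ∀ j < N, ∀ i, (X j i : ℝ) ≤ (x j i + σ) * Q := fun j hj i =>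
    Nat.floor_le (mul_nonneg (by linarith [(hxσ j hj i).1]) hQ'.le)
  have hXgt : ∀ j i, (x j i + σ) * Q < X j i + 1 := fun j i => Nat.lt_floor_add_one _
  have huX : ∀ j < N, ∀ i, (2 * d + 2) * u ≤ X j i := by
    intro j hj i
    have h1 := hXgt j i
    have h2 := (hxσ j hj i).1
    have h3 : ((2 * d + 2 : ℝ)) * u ≤ X j i := by
      have h4 : ((2 * d + 2 : ℝ)) * u ≤ (2 * d + 2) * (2 * (δ * Q)) := by gcongr
      have h5 : (8 * d + 8) * δ * Q ≤ 1 * Q := mul_le_mul_of_nonneg_right s3 hQ'.le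
      have h6 : 2 * (Q : ℝ) ≤ (x j i + σ) * Q := mul_le_mul_of_nonneg_right h2 hQ'.le
      have h7 : 0 ≤ (4 * d + 4) * δ * Q := by positivity
      linarith
    exact_mod_cast h3
  -- In grid units the `j`-th cell is the cube of half side `(2 * d + 2) * u` about the rounded
  -- centre `X j`. The starting points fill the smaller cube of half side `u` about it.
  set c : ℕ → Fin d → ℕ := fun j i => X j i - (2 * d + 2) * u with hc
  have hcX : ∀ j < N, ∀ i, (c j i : ℝ) = X j i - (2 * d + 2) * u := by
    intro j hj i
    rw [hc]; simp only
    rw [Nat.cast_sub (huX j hj i)]; push_cast; ring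
  have hcorner : ∀ j < N, ∀ i, |gridPoint σ Q (c j) i - x j i| ≤ (4 * d + 5) * δ := by
    intro j hj i
    have e : gridPoint σ Q (c j) i - x j i
        = ((X j i : ℝ) - (2 * d + 2) * u - (x j i + σ) * Q) / Q := by
      simp only [gridPoint, hcX j hj i]; field_simp; ring
    rw [e, abs_div, abs_of_pos hQ', div_le_iff₀ hQ', abs_le]
    have h1 := hXgt j i
    have h2 := hXle j hj i
    have h4 : ((2 * d + 2 : ℝ)) * u ≤ (2 * d + 2) * (2 * (δ * Q)) := by gcongr
    have h5 : (0 : ℝ) ≤ (2 * d + 2) * u := by positivity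
    have h6 : (4 * d + 5) * δ * Q = (2 * d + 2) * (2 * (δ * Q)) + δ * Q := by ring
    constructor <;> linarith
  have hball : ∀ j < N, Metric.closedBall (gridPoint σ Q (c j)) (r / 2) ⊆
      {y | Metric.infDist y A ≤ r} := by
    intro j hj y hy
    have h1 : ‖gridPoint σ Q (c j) - x j‖ ≤ d * ((4 * d + 5) * δ) :=
      norm_le_of_forall_abs_le (by positivity) fun i => by
        simpa using hcorner j hj i
    have h2 := Metric.mem_closedBall.1 hy
    have h3 : Metric.infDist y A ≤ dist y (x j) := Metric.infDist_le_dist_of_mem (hxA j hj)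
    have h4 := dist_triangle y (gridPoint σ Q (c j)) (x j)
    rw [dist_eq_norm (gridPoint σ Q (c j))] at h4
    have : Metric.infDist y A ≤ r := by linarith
    exact this
  have hpoly : ∀ j, ∃ a : Fin d → Word d k → ℝ, j < N → ∀ i, (∀ w, |a i w| ≤ Ci i) ∧
      ∀ h, ‖h‖ ≤ r / 2 → |f (gridPoint σ Q (c j) + h) i + σ - ∑ w, a i w * monom h w|
        ≤ Ci i * ‖h‖ ^ k := by
    intro j
    by_cases hj : j < N
    · choose a ha using fun i => hCi i _ _ (hball j hj)
      exact ⟨a, fun _ => ha⟩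
    · exact ⟨fun _ _ => 0, fun h => absurd h hj⟩
  choose a ha using hpoly
  refine ⟨u, c, fun j i w => ⌊(a j i w + κ) * Q⌋₊, ?_, ?_, ?_, ?_⟩
  · have : (8 * d + 8) * δ * Q ≤ 1 * Q := mul_le_mul_of_nonneg_right s3 hQ'.le
    have : 0 ≤ (8 * d + 6) * δ * Q := by positivity
    linarith
  · intro j hj i
    have h1 : (c j i : ℝ) ≤ 2 * σ * Q := by
      rw [hcX j hj i]
      have h2 := hXle j hj i
      have h3 := mul_le_mul_of_nonneg_right (hxσ j hj i).2 hQ'.le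
      have h5 : (0 : ℝ) ≤ (2 * d + 2) * u := by positivity
      linarith
    refine h1.trans (mul_le_mul_of_nonneg_right ?_ hQ'.le)
    have : 0 ≤ d * (ν + 1 + C₀ * D ^ k) := by positivity
    have : (0 : ℝ) ≤ κ := Nat.cast_nonneg _
    linarith
  · intro j hj i w
    have h1 := (abs_le.1 ((ha j hj i).1 w))
    have h2 : |a j i w| ≤ κ := ((ha j hj i).1 w).trans ((hCi_le i).trans hκ1)
    have h3 := abs_le.1 h2
    refine (Nat.floor_le (mul_nonneg (by linarith [h3.1]) hQ'.le)).trans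
      (mul_le_mul_of_nonneg_right ?_ hQ'.le)
    have : 0 ≤ d * (ν + 1 + C₀ * D ^ k) := by positivity
    have : (0 : ℝ) ≤ σ := Nat.cast_nonneg _
    linarith [h3.2]
  · intro c' a' hca
    have hstart : ∀ j < N, ∀ o : Fin d → ℕ, ∀ i,
        c' j i + (2 * d + 1) * u + o i + u = X j i + o i := by
      intro j hj o i
      rw [(hca j hj).1]
      have := huX j hj i
      simp only [hc]
      have e : (2 * d + 2) * u = (2 * d + 1) * u + u := by ring
      omega
    refine ⟨?_, ?_, ?_⟩
    · intro y hy
      obtain ⟨b, hb, hyb⟩ := hA.exists_infDist_eq_dist hne (gridPoint σ Q y)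
      obtain ⟨j₁, hj₁, hbj⟩ := hcov b hb
      -- The point is within `2 * d * δ` of some `b ∈ A`, and `b` is within `δ` of a centre:
      -- together `(2 * d + 1) * u` grid units, plus one more `u` for the rounding of the centre.
      have hin : ∃ j < N, ∀ i, c' j i ≤ y i ∧ y i ≤ c' j i + 2 * (2 * d + 2) * u := by
        refine ⟨j₁, hj₁, fun i => ?_⟩
        have h1 : |gridPoint σ Q y i - b i| ≤ 2 * d * δ := by
          have h2 := PiLp.norm_apply_le (gridPoint σ Q y - b) i
          rw [← dist_eq_norm, ← hyb] at h2
          exact h2.trans hy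
        have h2 : |b i - x j₁ i| ≤ δ := by
          have h2 := PiLp.norm_apply_le (b - x j₁) i
          rw [← dist_eq_norm] at h2
          exact h2.trans hbj
        have h3 : |gridPoint σ Q y i - x j₁ i| ≤ (2 * d + 1) * δ := by
          have := abs_sub_le (gridPoint σ Q y i) (b i) (x j₁ i)
          linarith
        have e : gridPoint σ Q y i - x j₁ i = ((y i : ℝ) - (x j₁ i + σ) * Q) / Q := by
          simp only [gridPoint]; field_simp; ring
        rw [e, abs_div, abs_of_pos hQ', div_le_iff₀ hQ', abs_le] at h3
        have h4 := hXgt j₁ i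
        have h5 := hXle j₁ hj₁ i
        have h6 : (2 * d + 1) * δ * Q ≤ (2 * d + 1) * u := by
          rw [mul_assoc]; gcongr
        have hu1' : (1 : ℝ) ≤ u := by linarith
        have h7 : (X j₁ i : ℝ) ≤ y i + (2 * d + 2) * u := by linarith [h3.1]
        have h8 : (y i : ℝ) ≤ X j₁ i + (2 * d + 2) * u := by linarith [h3.2]
        have h7' : X j₁ i ≤ y i + (2 * d + 2) * u := by exact_mod_cast h7
        have h8' : y i ≤ X j₁ i + (2 * d + 2) * u := by exact_mod_cast h8
        have h9 := huX j₁ hj₁ i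
        rw [(hca j₁ hj₁).1]
        simp only [hc]
        have e2 : 2 * (2 * d + 2) * u = (2 * d + 2) * u + (2 * d + 2) * u := by ring
        omega
      obtain ⟨hj, hjy⟩ := cellIndex_spec hin
      rw [cellMap]
      set j := cellIndex N (2 * (2 * d + 2) * u) c' y with hjdef
      obtain ⟨hc1, ha1⟩ := hca j hj
      rw [hc1] at hjy
      rw [hc1, ha1]
      set h : EuclideanSpace ℝ (Fin d) := gridPoint σ Q y - gridPoint σ Q (c j) with hh
      have hhi : ∀ i, h i = ((y i : ℝ) - c j i) / Q := by
        intro i; simp only [hh, gridPoint, PiLp.sub_apply]; ring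
      have hhb : ∀ i, 0 ≤ h i ∧ h i ≤ (8 * d + 8) * δ := by
        intro i
        have h1 : (c j i : ℝ) ≤ y i := by exact_mod_cast (hjy i).1
        have h2 : (y i : ℝ) ≤ c j i + 2 * (2 * d + 2) * u := by exact_mod_cast (hjy i).2
        rw [hhi]
        refine ⟨div_nonneg (by linarith) hQ'.le, ?_⟩
        rw [div_le_iff₀ hQ']
        have h4 : 2 * ((2 * d + 2 : ℝ)) * u ≤ 2 * (2 * d + 2) * (2 * (δ * Q)) := by gcongr
        linarith
      have hhn : ‖h‖ ≤ D * δ := by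
        rw [hD, mul_assoc]
        exact norm_le_of_forall_abs_le (by positivity) fun i => by
          rw [abs_of_nonneg (hhb i).1]; exact (hhb i).2
      have hfy : Metric.infDist (f (gridPoint σ Q y)) A ≤ 1 / 2 :=
        (hcontr _ (hy.trans s4)).trans (hy.trans s5)
      obtain ⟨b', hb', hfb⟩ := hA.exists_infDist_eq_dist hne (f (gridPoint σ Q y))
      have herr : ∀ i, |f (gridPoint σ Q y) i + σ - ∑ w, a j i w * monom h w|
          ≤ C₀ * D ^ k * δ ^ k := by
        intro i
        have h1 := (ha j hj i).2 h (hhn.trans s2)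
        rw [hh, add_sub_cancel, ← hh] at h1
        refine h1.trans ?_
        rw [mul_assoc, ← mul_pow]
        have := hCi_le i
        gcongr
      -- Shifted coordinates of points of `A` are at least `2`. Losing `1 / 2` for the distance of
      -- `f y` to `A` and `1 / 2` for the polynomial error leaves at least `1`, and `ν ≤ Q`.
      have hval : ∀ i, ν ≤ Q * ∑ w, a j i w * monom h w := by
        intro i
        have h1 : |f (gridPoint σ Q y) i - b' i| ≤ 1 / 2 := by
          have h2 := PiLp.norm_apply_le (f (gridPoint σ Q y) - b') i
          rw [← dist_eq_norm, ← hfb] at h2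
          exact h2.trans hfy
        have h2 := hσ b' hb' i
        have h3 := abs_le.1 (herr i)
        have h4 : C₀ * D ^ k * δ ^ k ≤ 1 / 2 := by
          refine le_trans ?_ s6
          gcongr
        have h5 : 1 ≤ ∑ w, a j i w * monom h w := by
          linarith [(abs_le.1 h1).1, neg_abs_le (b' i), h3.2]
        have h6 : ν ≤ Q := by
          have : ν * δ ≤ Q * δ := by linarith
          exact le_of_mul_le_mul_right this hδ
        exact h6.trans (le_mul_of_one_le_right hQ'.le h5)
      have hround := fun i => abs_polyMap_sub_le hQ (fun i => (hjy i).1) hhi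
        (fun i => (hhb i).2.trans s3) (a := a j) (κ := κ)
        (fun i w => ((ha j hj i).1 w).trans ((hCi_le i).trans hκ1)) i (hval i)
      have hfin : ∀ i, |(gridPoint σ Q (polyMap κ Q (c j) (fun i w => ⌊(a j i w + κ) * Q⌋₊) y)
          - f (gridPoint σ Q y)) i| ≤ (ν + 1 + C₀ * D ^ k) * δ ^ k := by
        intro i
        have h1 := abs_le.1 (hround i)
        have h2 := abs_le.1 (herr i)
        have h3 : (ν + 1) / Q ≤ (ν + 1) * δ ^ k := by
          rw [div_le_iff₀ hQ', mul_assoc]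
          exact le_mul_of_one_le_right (by positivity) hQk
        have e : (gridPoint σ Q (polyMap κ Q (c j) (fun i w => ⌊(a j i w + κ) * Q⌋₊) y)
          - f (gridPoint σ Q y)) i =
          (polyMap κ Q (c j) (fun i w => ⌊(a j i w + κ) * Q⌋₊) y i : ℝ) / Q - σ
            - f (gridPoint σ Q y) i := by
          simp only [gridPoint, PiLp.sub_apply]
        rw [e, abs_le]
        constructor <;> linarith [h1.1, h1.2, h2.1, h2.2]
      refine (norm_le_of_forall_abs_le (by positivity) hfin).trans ?_
      rw [← mul_assoc]
      have : (0 : ℝ) ≤ σ := Nat.cast_nonneg _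
      have : (0 : ℝ) ≤ κ := Nat.cast_nonneg _
      gcongr
      linarith
    · intro j hj o ho
      refine (Metric.infDist_le_dist_of_mem (hxA j hj)).trans ?_
      rw [dist_eq_norm]
      have e2 : 2 * (d : ℝ) * δ = d * (2 * δ) := by ring
      rw [e2]
      refine norm_le_of_forall_abs_le (by positivity) fun i => ?_
      have h1 : ((c' j i + (2 * d + 1) * u + o i : ℕ) : ℝ) + u = X j i + o i := by
        exact_mod_cast hstart j hj o i
      have h2 : (o i : ℝ) ≤ 2 * u := by
        have := ho i
        exact_mod_cast (by omega : o i ≤ 2 * u)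
      have h3 : (0 : ℝ) ≤ o i := Nat.cast_nonneg _
      have e : ((gridPoint σ Q fun i => c' j i + (2 * d + 1) * u + o i) - x j) i =
          (((c' j i + (2 * d + 1) * u + o i : ℕ) : ℝ) - (x j i + σ) * Q) / Q := by
        simp only [gridPoint, PiLp.sub_apply]; field_simp; ring
      rw [e, abs_div, abs_of_pos hQ', div_le_iff₀ hQ', abs_le]
      have h4 := hXgt j i
      have h5 := hXle j hj i
      constructor <;> linarith
    · intro b hb
      obtain ⟨j, hj, hbj⟩ := hcov b hb
      have hbσ : ∀ i, 0 ≤ b i + σ := fun i => by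
        linarith [hσ b hb i, neg_abs_le (b i)]
      have hbx : ∀ i, |b i - x j i| ≤ δ := fun i => by
        have h2 := PiLp.norm_apply_le (b - x j) i
        rw [← dist_eq_norm] at h2
        exact h2.trans hbj
      set y : Fin d → ℕ := fun i => ⌊(b i + σ) * Q⌋₊ with hy
      have hy1 : ∀ i, y i ≤ X j i + u := by
        intro i
        have h1 := (abs_le.1 (hbx i)).2
        have h2 : 0 ≤ (x j i + σ) * Q :=
          mul_nonneg (by linarith [(hxσ j hj i).1]) hQ'.le
        rw [hy, hX]; simp only
        rw [← Nat.floor_add_natCast h2]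
        refine Nat.floor_le_floor ?_
        have := mul_le_mul_of_nonneg_right h1 hQ'.le
        linarith
      have hy2 : ∀ i, X j i ≤ y i + u := by
        intro i
        have h1 := (abs_le.1 (hbx i)).1
        rw [hy, hX]; simp only
        rw [← Nat.floor_add_natCast (mul_nonneg (hbσ i) hQ'.le)]
        refine Nat.floor_le_floor ?_
        have := mul_le_mul_of_nonneg_right h1 hQ'.le
        linarith
      refine ⟨j, hj, fun i => y i + u - X j i, fun i => ?_, ?_⟩
      · have := hy1 i
        change y i + u - X j i < 2 * u + 1
        omega
      · have e : (fun i => c' j i + (2 * d + 1) * u + (y i + u - X j i)) = y := by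
          ext i
          have h1 : c' j i + (2 * d + 1) * u + (y i + u - X j i) + u
              = X j i + (y i + u - X j i) := hstart j hj (fun i => y i + u - X j i) i
          have h2 := hy2 i
          omega
        rw [e, ← mul_one_div]
        refine norm_le_of_forall_abs_le (by positivity) fun i => ?_
        simpa [gridPoint] using abs_gridPoint_floor_sub_le hQ (hbσ i)

/-! ### Bounds for the distortion complexity -/

theorem distortionComplexity_le {U : Machine d} {p : List Bool} {L : List (Fin d → ℤ × ℕ)}
    (hL : L ∈ U p) {ε : ℝ} {F : Set (EuclideanSpace ℝ (Fin d))}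
    (h : Metric.hausdorffEDist F (pointSet L) ≤ ENNReal.ofReal ε) :
    distortionComplexity U ε F ≤ p.length :=
  iInf₂_le (f := fun (p : List Bool) (_ : p ∈ {p : List Bool | ∃ L ∈ U p,
    Metric.hausdorffEDist F (pointSet L) ≤ ENNReal.ofReal ε}) => (p.length : ℕ∞)) p ⟨L, hL, h⟩

theorem hausdorffEDist_le_ofReal {F S : Set (EuclideanSpace ℝ (Fin d))} {ε : ℝ}
    (hne : F.Nonempty) (h1 : ∀ a ∈ F, ∃ s ∈ S, dist a s ≤ ε) (h2 : ∀ s ∈ S, Metric.infDist s F ≤ ε) :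
    Metric.hausdorffEDist F S ≤ ENNReal.ofReal ε := by
  refine Metric.hausdorffEDist_le_of_infEDist (fun a ha => ?_) fun s hs => ?_
  · obtain ⟨s, hs, has⟩ := h1 a ha
    refine (Metric.infEDist_le_edist_of_mem hs).trans ?_
    rw [edist_dist]
    exact ENNReal.ofReal_le_ofReal has
  · rw [← ENNReal.ofReal_toReal (Metric.infEDist_ne_top hne)]
    exact ENNReal.ofReal_le_ofReal (h2 s hs)

/-- The distortion complexity of a set that is described by a piecewise polynomial map with `N`
cells and parameters of `b` bits is of order at most `b * N`. -/
theorem exists_distortionComplexity_le {U : Machine d} (hU : IsUniversal U) (k σ κ : ℕ) :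
    ∃ C : ℝ, 0 < C ∧ ∀ (b n N u Q : ℕ) (c : ℕ → Fin d → ℕ) (a : ℕ → Fin d → Word d k → ℕ),
      1 ≤ b → 1 ≤ N → n < 2 ^ b → N < 2 ^ b → u < 2 ^ b → 0 < Q → Q < 2 ^ b →
      (∀ j < N, ∀ i, c j i < 2 ^ b) → (∀ j < N, ∀ i w, a j i w < 2 ^ b) →
      ∃ (c' : ℕ → Fin d → ℕ) (a' : ℕ → Fin d → Word d k → ℕ),
        (∀ j < N, c' j = c j ∧ a' j = a j) ∧
        ∀ (ε : ℝ) (A : Set (EuclideanSpace ℝ (Fin d))), A.Nonempty →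
          (∀ j < N, ∀ o : Fin d → ℕ, (∀ i, o i < 2 * u + 1) →
            Metric.infDist (gridPoint σ Q ((cellMap κ N (2 * (2 * d + 2) * u) Q c' a')^[n]
              fun i => c' j i + (2 * d + 1) * u + o i)) A ≤ ε) →
          (∀ x ∈ A, ∃ j < N, ∃ o : Fin d → ℕ, (∀ i, o i < 2 * u + 1) ∧
            dist x (gridPoint σ Q ((cellMap κ N (2 * (2 * d + 2) * u) Q c' a')^[n]
              fun i => c' j i + (2 * d + 1) * u + o i)) ≤ ε) →
          (distortionComplexity U ε A : ENNReal) ≤ ENNReal.ofReal (C * (b * N)) := by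
  obtain ⟨D, hD, hDspec⟩ := exists_decoder d k σ κ
  obtain ⟨cU, hcU⟩ := hU.2 D hD
  set K := Fintype.card (Field d k)
  -- The program has length `b + 1 + b * (4 + N * K) + cU`, and `b`, `1` are at most `b * N`.
  refine ⟨(6 + K + cU : ℕ), by positivity, ?_⟩
  intro b n N u Q c a hb hN1 hn hN hu hQ0 hQ hc ha
  obtain ⟨p, L, c', a', hp, hL, hagree, hset⟩ := hDspec b n N u Q c a hn hN hu hQ0 hQ hc ha
  refine ⟨c', a', hagree, fun ε A hne h1 h2 => ?_⟩
  obtain ⟨q, hq, hLq⟩ := hcU p L hL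
  have hle : distortionComplexity U ε A ≤ q.length := by
    refine distortionComplexity_le hLq (hausdorffEDist_le_ofReal hne ?_ ?_)
    · intro x hx
      obtain ⟨j, hj, o, ho, hd⟩ := h2 x hx
      exact ⟨_, by rw [hset]; exact ⟨j, hj, o, ho, rfl⟩, hd⟩
    · intro s hs
      rw [hset] at hs
      obtain ⟨j, hj, o, ho, rfl⟩ := hs
      exact h1 j hj o ho
  have hlen : q.length ≤ (6 + K + cU) * (b * N) := by
    have h3 : 1 ≤ b * N := Nat.mul_pos hb hN1
    have h4 : b ≤ b * N := Nat.le_mul_of_pos_right b hN1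
    have h5 : cU ≤ cU * (b * N) := Nat.le_mul_of_pos_right cU h3
    rw [hp] at hq
    calc q.length ≤ b + 1 + b * (4 + N * K) + cU := hq
      _ = b + 1 + 4 * b + K * (b * N) + cU := by ring
      _ ≤ b * N + b * N + 4 * (b * N) + K * (b * N) + cU * (b * N) := by omega
      _ = _ := by ring
  calc (distortionComplexity U ε A : ENNReal) ≤ ((q.length : ℕ∞) : ENNReal) :=
        ENat.toENNReal_le.2 hle
    _ = ENNReal.ofReal (q.length : ℝ) := by simp
    _ ≤ _ := ENNReal.ofReal_le_ofReal (by exact_mod_cast hlen)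

theorem eventually_rpow_le (C : ℝ) {c x y : ℝ} (hc : 0 < c) (hxy : y < x) :
    ∀ᶠ ε : ℝ in 𝓝[>] 0, C * ε ^ x ≤ c * ε ^ y := by
  have h : Tendsto (fun ε : ℝ => C * ε ^ (x - y)) (𝓝[>] 0) (𝓝 (C * 0)) := by
    have h1 := (Real.continuousAt_rpow_const 0 (x - y) (Or.inr (by linarith))).tendsto
    rw [Real.zero_rpow (by linarith)] at h1
    exact (h1.const_mul C).mono_left nhdsWithin_le_nhds
  rw [mul_zero] at h
  filter_upwards [h.eventually_le_const hc, self_mem_nhdsWithin] with ε h1 (h2 : 0 < ε)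
  have h3 : ε ^ x = ε ^ (x - y) * ε ^ y := by rw [← Real.rpow_add h2]; ring_nf
  rw [h3, ← mul_assoc]
  exact mul_le_mul_of_nonneg_right h1 (Real.rpow_nonneg h2.le _)

/-- Numbers that are polynomial in `1 / ε` have `O(log (1 / ε))` binary digits. -/
theorem exists_bits (C t : ℝ) : ∃ ζ : ℝ, 0 < ζ ∧ ∀ᶠ ε : ℝ in 𝓝[>] 0, ∃ b : ℕ, 1 ≤ b ∧
    (b : ℝ) ≤ ζ * Real.log ε⁻¹ ∧ C * ε ^ (-t) < 2 ^ b := by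
  -- The factor `2` dominates `1 / log 2`, the extra power of `1 / ε` absorbs `C`, and the last `1`
  -- pays for rounding up.
  refine ⟨2 * (|t| + 1) + 1, by positivity, ?_⟩
  filter_upwards [eventually_rpow_le (C + 1) (x := -t) (y := -(|t| + 1)) one_pos
    (by linarith [le_abs_self t]), eventually_pos_lt one_pos,
    tendsto_log_inv_nhdsGT.eventually_ge_atTop 1] with ε h1 hε hlog
  set l := Real.log ε⁻¹ with hl
  have ht : 0 ≤ |t| := abs_nonneg t
  refine ⟨⌈2 * (|t| + 1) * l⌉₊, ?_, ?_, ?_⟩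
  · exact Nat.one_le_ceil_iff.2 (by positivity)
  · have := (Nat.ceil_lt_add_one (show 0 ≤ 2 * (|t| + 1) * l by positivity)).le
    nlinarith
  · have hpos : 0 < ε ^ (-t) := Real.rpow_pos_of_pos hε.1 _
    have h2 : C * ε ^ (-t) < ε ^ (-(|t| + 1)) := by linarith
    refine h2.trans_le ?_
    rw [← Real.rpow_natCast, Real.rpow_def_of_pos hε.1, Real.rpow_def_of_pos two_pos,
      Real.exp_le_exp]
    have h3 : Real.log ε = -l := by rw [hl, Real.log_inv, neg_neg]
    have h4 := Nat.le_ceil (2 * (|t| + 1) * l)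
    have h5 := Real.log_two_gt_d9
    rw [h3]
    have h6 : 0 ≤ 2 * (|t| + 1) * l := by positivity
    nlinarith

/-- Listing the centres of a cover of `A` bounds the distortion complexity by the covering
numbers, up to a logarithm. -/
theorem exists_distortionComplexity_le_of_boxCount_le {U : Machine d} (hU : IsUniversal U)
    {A : Set (EuclideanSpace ℝ (Fin d))} (hA : IsCompact A) (hne : A.Nonempty) {C₀ s : ℝ}
    (h : ∀ᶠ ε : ℝ in 𝓝[>] 0, boxCount A ε ≤ C₀ * ε ^ (-s)) :
    ∃ C : ℝ, 0 < C ∧ ∀ᶠ ε : ℝ in 𝓝[>] 0, (distortionComplexity U ε A : ENNReal) ≤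
      ENNReal.ofReal (C * ε ^ (-s) * Real.log ε⁻¹ ^ 2) := by
  obtain ⟨σ, hσ⟩ := exists_abs_coord_le hA
  obtain ⟨C₁, hC₁, hdec⟩ := exists_distortionComplexity_le hU 0 σ 0
  set B : ℝ := |C₀| * 4 ^ s with hB
  have hB0 : 0 ≤ B := by positivity
  obtain ⟨ζ, hζ, hbits⟩ := exists_bits (B + (2 * σ + 1) * (2 * d + 2)) (max s 1)
  refine ⟨C₁ * ζ * (B + 1), by positivity, ?_⟩
  have h4 : Tendsto (fun ε : ℝ => ε / 4) (𝓝[>] 0) (𝓝[>] 0) := by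
    refine tendsto_nhdsWithin_iff.2 ⟨?_, ?_⟩
    · have : Tendsto (fun ε : ℝ => ε / 4) (𝓝 0) (𝓝 (0 / 4)) := tendsto_id.div_const 4
      rw [zero_div] at this
      exact this.mono_left nhdsWithin_le_nhds
    · filter_upwards [self_mem_nhdsWithin] with ε (hε : 0 < ε)
      exact (by positivity : 0 < ε / 4)
  filter_upwards [h4.eventually h, hbits, eventually_pos_lt one_pos,
    tendsto_log_inv_nhdsGT.eventually_ge_atTop 1] with ε hbox hb hε hlog
  obtain ⟨b, hb1, hbζ, hb2⟩ := hb
  -- The radius doubles to `ε / 2` when the centres are taken in `A`; the other `ε / 2` is left for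
  -- rounding them to the grid.
  obtain ⟨N, x, hN0, hN, hxA, hcov⟩ := exists_cover hA hne (show 0 < ε / 4 by linarith [hε.1])
  have hε0 := hε.1
  have hd0 : (0 : ℝ) ≤ d := Nat.cast_nonneg d
  have hσ0 : (0 : ℝ) ≤ σ := Nat.cast_nonneg σ
  have hNB : (N : ℝ) ≤ B * ε ^ (-s) := by
    refine hN.trans (hbox.trans ?_)
    rw [Real.div_rpow hε0.le (by norm_num), Real.rpow_neg (by norm_num : (0 : ℝ) ≤ 4), hB,
      div_inv_eq_mul]
    have := le_abs_self C₀
    have : 0 ≤ ε ^ (-s) * (4 : ℝ) ^ s := by positivity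
    nlinarith
  set Q := ⌈(2 * d + 1) / ε⌉₊ with hQdef
  have hQ1 : (2 * (d : ℝ) + 1) / ε ≤ Q := Nat.le_ceil _
  have hQ' : (0 : ℝ) < Q := lt_of_lt_of_le (by positivity) hQ1
  have hQ : 0 < Q := by exact_mod_cast hQ'
  have hQ2 : (Q : ℝ) ≤ (2 * d + 2) * ε ^ (-1 : ℝ) := by
    have h1 := (Nat.ceil_lt_add_one (show 0 ≤ (2 * (d : ℝ) + 1) / ε by positivity)).le
    rw [Real.rpow_neg_one]
    have h2 : 1 ≤ ε⁻¹ := (one_le_inv₀ hε0).2 hε.2.le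
    rw [← hQdef, div_eq_mul_inv] at h1
    linarith
  have hmono : ∀ t ≤ max s 1, ε ^ (-t) ≤ ε ^ (-max s 1) := fun t ht =>
    Real.rpow_le_rpow_of_exponent_ge hε0 hε.2.le (by linarith)
  have hms := hmono s (le_max_left _ _)
  have hm1 := hmono 1 (le_max_right _ _)
  have hm0 : 0 < ε ^ (-max s 1) := Real.rpow_pos_of_pos hε0 _
  have hQ3 : (Q : ℝ) ≤ (2 * d + 2) * ε ^ (-max s 1) :=
    hQ2.trans (mul_le_mul_of_nonneg_left hm1 (by positivity))
  have hNb : N < 2 ^ b := by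
    have : (N : ℝ) < 2 ^ b := by
      refine lt_of_le_of_lt ?_ hb2
      refine hNB.trans ((mul_le_mul_of_nonneg_left hms hB0).trans ?_)
      have : 0 ≤ (2 * (σ : ℝ) + 1) * (2 * d + 2) := by positivity
      exact mul_le_mul_of_nonneg_right (by linarith) hm0.le
    exact_mod_cast this
  have hQσ : (2 * σ + 1) * (Q : ℝ) < 2 ^ b := by
    refine lt_of_le_of_lt ?_ hb2
    calc (2 * σ + 1) * (Q : ℝ) ≤ (2 * σ + 1) * ((2 * d + 2) * ε ^ (-max s 1)) := by gcongr
      _ = (2 * σ + 1) * (2 * d + 2) * ε ^ (-max s 1) := by ring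
      _ ≤ _ := mul_le_mul_of_nonneg_right (by linarith) hm0.le
  have hQb : Q < 2 ^ b := by
    have : (Q : ℝ) < 2 ^ b := lt_of_le_of_lt (by nlinarith) hQσ
    exact_mod_cast this
  have hxσ : ∀ j < N, ∀ i, 0 ≤ x j i + σ ∧ x j i + σ ≤ 2 * σ := by
    intro j hj i
    have h1 := hσ _ (hxA j hj) i
    have h2 := abs_le.1 (le_refl |x j i|)
    constructor <;> linarith [h2.1, h2.2]
  -- With no iterations and `u = 0` the decoder simply prints the corners, here the rounded centres.
  obtain ⟨c', a', hagree, hfin⟩ := hdec b 0 N 0 Q (fun j i => ⌊(x j i + σ) * Q⌋₊)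
    (fun _ _ _ => 0) hb1 hN0 (by positivity) hNb (by positivity) hQ hQb
    (fun j hj i => by
      have h1 := Nat.floor_le (mul_nonneg (hxσ j hj i).1 hQ'.le)
      have h2 := mul_le_mul_of_nonneg_right (hxσ j hj i).2 hQ'.le
      have : (⌊(x j i + σ) * Q⌋₊ : ℝ) < 2 ^ b := by linarith
      exact_mod_cast this) (fun _ _ _ _ => by positivity)
  have hpt : ∀ j < N, ∀ o : Fin d → ℕ, (∀ i, o i < 2 * 0 + 1) →
      ‖gridPoint σ Q (fun i => c' j i + (2 * d + 1) * 0 + o i) - x j‖ ≤ ε / 2 := by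
    intro j hj o ho
    have h1 : ‖gridPoint σ Q (fun i => c' j i + (2 * d + 1) * 0 + o i) - x j‖ ≤ d * (1 / Q) := by
      refine norm_le_of_forall_abs_le (by positivity) fun i => ?_
      have h2 := abs_gridPoint_floor_sub_le hQ (hxσ j hj i).1
      have h3 : o i = 0 := by have := ho i; omega
      simpa [gridPoint, h3, (hagree j hj).1] using h2
    refine h1.trans ?_
    rw [mul_one_div, div_le_iff₀ hQ']
    rw [div_le_iff₀ hε0] at hQ1
    linarith
  refine (hfin ε A hne ?_ ?_).trans (ENNReal.ofReal_le_ofReal ?_)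
  · intro j hj o ho
    simp only [Function.iterate_zero, id]
    refine (Metric.infDist_le_dist_of_mem (hxA j hj)).trans ?_
    rw [dist_eq_norm]
    linarith [hpt j hj o ho]
  · intro y hy
    obtain ⟨j, hj, hyj⟩ := hcov y hy
    refine ⟨j, hj, fun _ => 0, fun _ => by simp, ?_⟩
    simp only [Function.iterate_zero, id]
    have h1 := hpt j hj (fun _ => 0) fun _ => by simp
    rw [← dist_eq_norm, dist_comm] at h1
    refine (dist_triangle y (x j) _).trans ?_
    linarith
  · have hs0 : 0 < ε ^ (-s) := Real.rpow_pos_of_pos hε0 _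
    have h1 : (b : ℝ) * N ≤ ζ * Real.log ε⁻¹ * ((B + 1) * ε ^ (-s)) :=
      mul_le_mul hbζ (hNB.trans (by nlinarith)) (Nat.cast_nonneg _) (by positivity)
    have h2 : Real.log ε⁻¹ ≤ Real.log ε⁻¹ ^ 2 := by nlinarith
    calc C₁ * ((b : ℝ) * N) ≤ C₁ * (ζ * Real.log ε⁻¹ * ((B + 1) * ε ^ (-s))) := by gcongr
      _ = C₁ * ζ * (B + 1) * ε ^ (-s) * Real.log ε⁻¹ := by ring
      _ ≤ _ := by gcongr

/-- The choice of the cell size `ε ^ θ` and of the number `β log (1 / ε)` of iterations. -/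
theorem exists_exponents {a l : ℝ} (ha : 0 < a) (hl : 0 < l) (hk : 2 ≤ k) :
    ∃ θ β : ℝ, 0 < θ ∧ θ < 1 ∧ 0 < β ∧ θ < (l + a / k) / (l + a) ∧ 1 < a * β + θ ∧
      1 + l * β < k * θ := by
  have hk' : (2 : ℝ) ≤ k := by exact_mod_cast hk
  -- The left side is the least `θ` beyond which `(1 - θ) / a < β < (k θ - 1) / l` can be solved for
  -- `β`. After clearing denominators the inequality becomes `k + 1 / k > 2`.
  have hlt : (l + a) / (l + k * a) < (l + a / k) / (l + a) := by
    rw [div_lt_div_iff₀ (by positivity) (by positivity)]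
    have h1 : (l + a / k) * (l + k * a) = l ^ 2 + (k + 1 / k) * (l * a) + a ^ 2 := by
      field_simp; ring
    have h2 : (2 : ℝ) < k + 1 / k := by
      have : (0 : ℝ) < 1 / k := by positivity
      linarith
    rw [h1]
    nlinarith [mul_pos hl ha]
  obtain ⟨θ, hθ1, hθ2⟩ := exists_between hlt
  have hα : (l + a / k) / (l + a) ≤ 1 := by
    rw [div_le_one (by positivity)]
    have : a / k ≤ a := div_le_self ha.le (by linarith)
    linarith
  have hθ0 : 0 < θ := lt_trans (by positivity) hθ1
  rw [div_lt_iff₀ (by positivity)] at hθ1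
  have hβ : (1 - θ) / a < (k * θ - 1) / l := by
    rw [div_lt_div_iff₀ ha hl]
    linarith
  obtain ⟨β, hβ1, hβ2⟩ := exists_between hβ
  have hβ0 : 0 < β := lt_of_le_of_lt (div_nonneg (by linarith) ha.le) hβ1
  rw [div_lt_iff₀ ha] at hβ1
  rw [lt_div_iff₀ hl] at hβ2
  exact ⟨θ, β, hθ0, by linarith, hβ0, hθ2, by linarith, by linarith⟩

theorem tendsto_rpow_nhdsGT {θ : ℝ} (hθ : 0 < θ) :
    Tendsto (fun ε : ℝ => ε ^ θ) (𝓝[>] 0) (𝓝[>] 0) := by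
  refine tendsto_nhdsWithin_iff.2 ⟨?_, ?_⟩
  · have h1 := (Real.continuousAt_rpow_const 0 θ (Or.inr hθ.le)).tendsto
    rw [Real.zero_rpow hθ.ne'] at h1
    exact h1.mono_left nhdsWithin_le_nhds
  · filter_upwards [self_mem_nhdsWithin] with ε (hε : 0 < ε)
    exact Real.rpow_pos_of_pos hε θ

set_option maxHeartbeats 1600000 in
/-- The distortion complexity of an attractor of a smooth map, through the iteration of piecewise
polynomial approximations of the map. -/
theorem exists_distortionComplexity_le_of_smooth (hd : 1 ≤ d) (hk : 2 ≤ k) {U : Machine d}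
    (hU : IsUniversal U) {f : EuclideanSpace ℝ (Fin d) → EuclideanSpace ℝ (Fin d)}
    {A W : Set (EuclideanSpace ℝ (Fin d))} (hA : IsCompact A) (hne : A.Nonempty)
    (hfA : f '' A = A) (hW : IsOpen W) (hf : ContDiffOn ℝ k f W) {r : ℝ} (hr : 0 < r)
    (hrW : ∀ y, Metric.infDist y A ≤ r → y ∈ W) {lm lp : ℝ} (hlm : lm < 0) (hlp : 0 < lp)
    (hcontr : ∀ y, Metric.infDist y A ≤ r →
      Metric.infDist (f y) A ≤ Real.exp lm * Metric.infDist y A)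
    (hexp : ∀ a ∈ A, ∀ y, ‖y - a‖ ≤ r → ‖f y - f a‖ ≤ Real.exp lp * ‖y - a‖)
    {θ β s t : ℝ} (hθ0 : 0 < θ) (hθ1 : θ < 1) (hβ0 : 0 < β) (hcontr_exp : 1 < -lm * β + θ)
    (hexp_exp : 1 + lp * β < k * θ) (hs0 : 0 ≤ s) (hst : θ * s ≤ t)
    (hbox : ∀ᶠ ε : ℝ in 𝓝[>] 0, boxCount A ε ≤ ε ^ (-s)) :
    ∃ C : ℝ, 0 < C ∧ ∀ᶠ ε : ℝ in 𝓝[>] 0, (distortionComplexity U ε A : ENNReal) ≤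
      ENNReal.ofReal (C * ε ^ (-t) * Real.log ε⁻¹ ^ 2) := by
  have hd' : (1 : ℝ) ≤ d := by exact_mod_cast hd
  have hk' : (2 : ℝ) ≤ k := by exact_mod_cast hk
  set p := Real.exp lm with hp
  have hp0 : 0 < p := Real.exp_pos _
  have hp1 : p < 1 := by rw [hp]; exact Real.exp_lt_one_iff.2 hlm
  set q := Real.exp lp with hq
  have hq1 : 1 < q := Real.one_lt_exp_iff.2 hlp
  obtain ⟨σ, κ, C, δ₀, hC, hδ₀, hcells⟩ := exists_cells hA hne (by omega) hW hf hr hrW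
    (fun y hy => (hcontr y hy).trans (mul_le_of_le_one_left Metric.infDist_nonneg hp1.le))
  obtain ⟨C₁, hC₁, hdec⟩ := exists_distortionComplexity_le hU k σ κ
  -- The resolution `1 / Q ≤ ε ^ (k + 1)` is finer than `δ ^ k = ε ^ (k θ)`, so rounding is
  -- negligible, and `Q` is still polynomial in `1 / ε`.
  set g : ℝ := k + 1 with hg
  set B : ℝ := (β + 1) + 2 ^ s + 2 * (1 + C) with hB
  have h2s : (0 : ℝ) < 2 ^ s := by positivity
  have hB0 : 0 < B := by positivity
  obtain ⟨ζ, hζ, hbits⟩ := exists_bits B (1 + θ * s + g)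
  -- One constant for both errors: the jump `C * δ ^ k` at each step, and the initial rounding `d /
  -- Q ≤ d * δ ^ k`.
  set C₂ := C + d with hC₂
  set Λ := 1 + 1 / (q - 1) with hΛ
  have hΛ0 : 0 < Λ := by
    have : 0 < q - 1 := by linarith
    positivity
  refine ⟨C₁ * ζ * 2 ^ s, by positivity, ?_⟩
  have hhalf : Tendsto (fun ε : ℝ => ε ^ θ / 2) (𝓝[>] 0) (𝓝[>] 0) := by
    refine tendsto_nhdsWithin_iff.2 ⟨?_, ?_⟩
    · have := (((tendsto_nhdsWithin_iff.1 (tendsto_rpow_nhdsGT hθ0)).1).div_const 2)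
      rwa [zero_div] at this
    · filter_upwards [self_mem_nhdsWithin] with ε (hε : 0 < ε)
      have := Real.rpow_pos_of_pos hε θ
      exact (by positivity : 0 < ε ^ θ / 2)
  -- The conditions `e1` to `e6`: the grid is finer than `δ`; starting points lie in the
  -- `r`-neighbourhood; pseudo-orbits are trapped near `A`; the contracted initial distance and the
  -- accumulated jumps are each at most `ε / 2`; the expanded error is at most `ε`.
  filter_upwards [eventually_pos_lt one_pos, tendsto_log_inv_nhdsGT.eventually_ge_atTop 1,
    (tendsto_rpow_nhdsGT hθ0).eventually (eventually_pos_lt hδ₀),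
    hhalf.eventually hbox, hbits,
    eventually_rpow_le 2 (x := g) (y := θ) one_pos (by rw [hg]; linarith),
    eventually_rpow_le (2 * d) (x := θ) (y := 0) hr hθ0,
    eventually_rpow_le C₂ (x := k * θ) (y := θ)
      (show 0 < (1 - p) * (2 * d) from mul_pos (by linarith) (by linarith))
      (lt_mul_of_one_lt_left hθ0 (by linarith)),
    eventually_rpow_le (2 * d) (x := -lm * β + θ) (y := 1) one_half_pos hcontr_exp,
    eventually_rpow_le (C₂ / (1 - p)) (x := k * θ) (y := 1) one_half_pos
      (by linarith [mul_pos hlp hβ0]),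
    eventually_rpow_le (Λ * q * C₂) (x := -(lp * β) + k * θ) (y := 1) one_pos (by linarith),
    eventually_pos_lt hr]
    with ε hε hlog hδ hboxε hb e1 e2 e3 e4 e5 e6 hεr
  obtain ⟨b, hb1, hbζ, hb2⟩ := hb
  have hε0 := hε.1
  set δ := ε ^ θ with hδdef
  set l := Real.log ε⁻¹ with hl
  have hlε : Real.log ε = -l := by rw [hl, Real.log_inv, neg_neg]
  have hrpow : ∀ x : ℝ, ε ^ x = Real.exp (-(l * x)) := fun x => by
    rw [Real.rpow_def_of_pos hε0, hlε]; ring_nf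
  have hδpow : δ ^ k = ε ^ (k * θ) := by
    rw [hδdef, ← Real.rpow_natCast, ← Real.rpow_mul hε0.le, mul_comm]
  have hδ1 : δ ≤ 1 := Real.rpow_le_one hε0.le hε.2.le hθ0.le
  obtain ⟨N, x, hN0, hN, hxA, hcov⟩ := exists_cover hA hne (show 0 < δ / 2 by linarith [hδ.1])
  have hNs : (N : ℝ) ≤ 2 ^ s * ε ^ (-(θ * s)) := by
    refine hN.trans (hboxε.trans (le_of_eq ?_))
    rw [Real.div_rpow hδ.1.le two_pos.le, Real.rpow_neg two_pos.le, hδdef, ← Real.rpow_mul hε0.le,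
      div_inv_eq_mul, mul_comm, mul_neg]
  set Q := ⌈ε ^ (-g)⌉₊ with hQdef
  have hQ1 : ε ^ (-g) ≤ Q := Nat.le_ceil _
  have hg1 : 1 ≤ ε ^ (-g) := Real.one_le_rpow_of_pos_of_le_one_of_nonpos hε0 hε.2.le
    (by rw [hg]; linarith)
  have hQ' : (0 : ℝ) < Q := by linarith
  have hQ : 0 < Q := by exact_mod_cast hQ'
  have hQ2 : (Q : ℝ) ≤ 2 * ε ^ (-g) := by
    have := (Nat.ceil_lt_add_one (show 0 ≤ ε ^ (-g) by linarith)).le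
    linarith
  have hgg : ε ^ g * ε ^ (-g) = 1 := by
    rw [← Real.rpow_add hε0, add_neg_cancel, Real.rpow_zero]
  have hQδ : 2 ≤ δ * Q := by
    rw [one_mul] at e1
    calc (2 : ℝ) = 2 * ε ^ g * ε ^ (-g) := by rw [mul_assoc, hgg, mul_one]
      _ ≤ δ * Q := mul_le_mul e1 hQ1 (by linarith) hδ.1.le
  have hQδk : 1 ≤ δ ^ k * Q := by
    have h1 : ε ^ g ≤ δ ^ k := by
      rw [hδpow]
      exact Real.rpow_le_rpow_of_exponent_ge hε0 hε.2.le (by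
        have := mul_le_of_le_one_right (by linarith : (0 : ℝ) ≤ k) hθ1.le
        linarith)
    calc (1 : ℝ) = ε ^ g * ε ^ (-g) := hgg.symm
      _ ≤ δ ^ k * Q := mul_le_mul h1 hQ1 (by linarith) (pow_nonneg hδ.1.le _)
  obtain ⟨u, c, a, huQ, hcQ, haQ, happ⟩ := hcells δ hδ.1 hδ.2 Q hQδ hQδk N x hxA (by
    rwa [show 2 * (δ / 2) = δ by ring] at hcov)
  set n := ⌈β * l⌉₊ with hn
  have hn1 : β * l ≤ n := Nat.le_ceil _
  have hn2 : (n : ℝ) ≤ β * l + 1 := (Nat.ceil_lt_add_one (by positivity)).le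
  have hsg0 : 0 ≤ θ * s := mul_nonneg hθ0.le hs0
  have hg0 : 0 ≤ g := by rw [hg]; linarith
  have hmono : ∀ y ≤ 1 + θ * s + g, ε ^ (-y) ≤ ε ^ (-(1 + θ * s + g)) := fun y hy =>
    Real.rpow_le_rpow_of_exponent_ge hε0 hε.2.le (by linarith)
  set T := ε ^ (-(1 + θ * s + g)) with hT
  have hT0 : 0 < T := Real.rpow_pos_of_pos hε0 _
  have hTg := hmono g (by linarith)
  have hTs := hmono (θ * s) (by linarith)
  have hT1 := hmono 1 (by linarith)
  have hnb : n < 2 ^ b := by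
    have h1 : l ≤ ε ^ (-1 : ℝ) := by
      rw [Real.rpow_neg_one]
      exact (Real.log_le_sub_one_of_pos (inv_pos.2 hε0)).trans (by linarith)
    have h2 : (n : ℝ) < 2 ^ b := by
      refine lt_of_le_of_lt ?_ hb2
      have h3 : (n : ℝ) ≤ (β + 1) * T := by
        have := mul_le_mul_of_nonneg_left (h1.trans hT1) hβ0.le
        linarith
      have h4 : 0 ≤ (2 ^ s + 2 * (1 + C)) * T := by positivity
      rw [hB]; linarith
    exact_mod_cast h2
  have hNb : N < 2 ^ b := by
    have h2 : (N : ℝ) < 2 ^ b := by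
      refine lt_of_le_of_lt ?_ hb2
      have h3 : (N : ℝ) ≤ 2 ^ s * T := hNs.trans (mul_le_mul_of_nonneg_left hTs h2s.le)
      have h4 : 0 ≤ (β + 1 + 2 * (1 + C)) * T := by positivity
      rw [hB]; linarith
    exact_mod_cast h2
  have hQC : (1 + C) * (Q : ℝ) < 2 ^ b := by
    refine lt_of_le_of_lt ?_ hb2
    have h3 : (1 + C) * (Q : ℝ) ≤ (1 + C) * (2 * T) :=
      mul_le_mul_of_nonneg_left (by linarith) (by positivity)
    have h4 : 0 ≤ (β + 1 + 2 ^ s) * T := by positivity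
    rw [hB]; linarith
  have hCQ : 0 < C * Q := by positivity
  have hQb : Q < 2 ^ b := by
    have h2 : (Q : ℝ) < 2 ^ b := by linarith
    exact_mod_cast h2
  obtain ⟨c', a', hagree, hfin⟩ := hdec b n N u Q c a hb1 hN0 hnb hNb
    (by
      have h2 : (u : ℝ) < 2 ^ b := by linarith
      exact_mod_cast h2) hQ hQb
    (fun j hj i => by
      have h2 : (c j i : ℝ) < 2 ^ b := by linarith [hcQ j hj i]
      exact_mod_cast h2)
    (fun j hj i w => by
      have h2 : (a j i w : ℝ) < 2 ^ b := by linarith [haQ j hj i w]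
      exact_mod_cast h2)
  obtain ⟨hstep, hstart, hdense⟩ := happ c' a' hagree
  set G := cellMap κ N (2 * (2 * d + 2) * u) Q c' a' with hG
  have hδk0 : 0 < δ ^ k := pow_pos hδ.1 k
  have hd0 : (0 : ℝ) ≤ d := by linarith
  have hτ0 : 0 ≤ C₂ * δ ^ k := by rw [hC₂]; positivity
  have hCτ : C * δ ^ k ≤ C₂ * δ ^ k :=
    mul_le_mul_of_nonneg_right (by rw [hC₂]; linarith) hδk0.le
  have hdτ : (d : ℝ) / Q ≤ C₂ * δ ^ k := by
    rw [div_le_iff₀ hQ', mul_assoc]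
    calc (d : ℝ) ≤ C₂ * 1 := by rw [hC₂]; linarith
      _ ≤ _ := mul_le_mul_of_nonneg_left hQδk (by rw [hC₂]; linarith)
  have hRr : 2 * d * δ ≤ r := by
    rw [Real.rpow_zero, mul_one] at e2; exact e2
  have hτR : C₂ * δ ^ k ≤ (1 - p) * (2 * d * δ) := by
    rw [hδpow, ← mul_assoc]; exact e3
  have hqn : q ^ n ≤ q * ε ^ (-(lp * β)) := by
    rw [hrpow, hq, ← Real.exp_nat_mul, ← Real.exp_add, Real.exp_le_exp]
    have := mul_le_mul_of_nonneg_right hn2 hlp.le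
    linarith
  have hpn : p ^ n ≤ ε ^ (-lm * β) := by
    rw [hrpow, hp, ← Real.exp_nat_mul, Real.exp_le_exp]
    have := mul_le_mul_of_nonpos_right hn1 hlm.le
    linarith
  have hexpn : Λ * q ^ n * (C₂ * δ ^ k) ≤ ε := by
    rw [one_mul, Real.rpow_one, Real.rpow_add hε0, ← hδpow] at e6
    refine le_trans ?_ e6
    calc Λ * q ^ n * (C₂ * δ ^ k) ≤ Λ * (q * ε ^ (-(lp * β))) * (C₂ * δ ^ k) := by gcongr
      _ = _ := by ring
  set orb : (Fin d → ℕ) → ℕ → EuclideanSpace ℝ (Fin d) := fun y i => gridPoint σ Q (G^[i] y)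
    with horb
  have horb_step : ∀ y i, Metric.infDist (orb y i) A ≤ 2 * d * δ →
      ‖orb y (i + 1) - f (orb y i)‖ ≤ C₂ * δ ^ k := by
    intro y i hi
    simp only [horb, Function.iterate_succ_apply']
    exact (hstep _ hi).trans hCτ
  refine (hfin ε A hne ?_ ?_).trans (ENNReal.ofReal_le_ofReal ?_)
  · intro j hj o ho
    have h1 := (infDist_pseudoOrbit_le (z := orb fun i => c' j i + (2 * d + 1) * u + o i)
      hp0.le hp1 hRr hτR hcontr (hstart j hj o ho) (horb_step _) n).2
    refine h1.trans ?_
    have h2 : p ^ n * (2 * d * δ) ≤ 1 / 2 * ε := by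
      rw [Real.rpow_one, Real.rpow_add hε0] at e4
      refine le_trans ?_ e4
      calc p ^ n * (2 * d * δ) ≤ ε ^ (-lm * β) * (2 * d * δ) :=
            mul_le_mul_of_nonneg_right hpn (by have := hδ.1; positivity)
        _ = _ := by rw [hδdef]; ring
    have h3 : C₂ * δ ^ k / (1 - p) ≤ 1 / 2 * ε := by
      rw [Real.rpow_one, ← hδpow] at e5
      refine le_trans (le_of_eq ?_) e5
      ring
    have h4 : C₂ * δ ^ k / (1 - p) * (1 - p ^ n) ≤ C₂ * δ ^ k / (1 - p) :=
      mul_le_of_le_one_right (div_nonneg hτ0 (by linarith))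
        (by linarith [pow_pos hp0 n])
    linarith
  · intro y hy
    -- Points of `A` are approximated through an `n`-th preimage in `A`: the grid is dense enough
    -- near the preimage, and the error is followed forward.
    obtain ⟨b₀, hb₀, hfb⟩ : ∃ b₀ ∈ A, f^[n] b₀ = y := by
      have himg : f^[n] '' A = A := by
        clear_value n
        clear * - hfA
        induction n with
        | zero => simp
        | succ n ih => rw [Function.iterate_succ, image_comp, hfA, ih]
      rw [← himg] at hy
      exact hy
    obtain ⟨j, hj, o, ho, hob⟩ := hdense b₀ hb₀
    refine ⟨j, hj, o, ho, ?_⟩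
    have h1 := norm_pseudoOrbit_sub_le
      (z := orb fun i => c' j i + (2 * d + 1) * u + o i)
      hp0.le hp1 hq1 hτ0 hRr hτR hcontr hfA hexp (hstart j hj o ho) (horb_step _) hb₀
      (hob.trans hdτ) (n := n) (hexpn.trans hεr.2.le)
    rw [hfb, ← dist_eq_norm, dist_comm] at h1
    exact h1.trans hexpn
  · have h1 : ε ^ (-(θ * s)) ≤ ε ^ (-t) :=
      Real.rpow_le_rpow_of_exponent_ge hε0 hε.2.le (by linarith)
    have ht0 : 0 < ε ^ (-t) := Real.rpow_pos_of_pos hε0 _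
    have h2 : (b : ℝ) * N ≤ ζ * l * (2 ^ s * ε ^ (-t)) :=
      mul_le_mul hbζ (hNs.trans (mul_le_mul_of_nonneg_left h1 h2s.le)) (Nat.cast_nonneg _)
        (by positivity)
    have h3 : l ≤ l ^ 2 := le_self_pow₀ hlog two_ne_zero
    calc C₁ * ((b : ℝ) * N) ≤ C₁ * (ζ * l * (2 ^ s * ε ^ (-t))) := by gcongr
      _ = C₁ * ζ * 2 ^ s * ε ^ (-t) * l := by ring
      _ ≤ _ := by gcongr

end Distortion

/-! ### The main theorem: separation of the cases -/

theorem mainTheorem2 {d k : ℕ} (hd : 2 ≤ d) (hk : 1 ≤ k)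
    (U : Distortion.Machine d) (hU : Distortion.IsUniversal U)
    (f : EuclideanSpace ℝ (Fin d) → EuclideanSpace ℝ (Fin d))
    (M W A V : Set (EuclideanSpace ℝ (Fin d)))
    (hM : IsCompact M) (hf : Distortion.IsDiffeoOn k f M W)
    (hA : Distortion.IsAttractor f M A)
    (hAV : V ∈ 𝓝ˢ A) (hVW : V ⊆ W)
    (hhyp : Distortion.UniformlyHyperbolicOn f V)
    (lm lp : ℝ) (hlm : lm < 0) (hlp : 0 < lp)
    (hexp : ∀ x ∈ V, ‖fderiv ℝ f x‖ ≤ Real.exp lp)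
    (hcontr : ∀ y ∈ V, Metric.infDist (f y) A ≤ Real.exp lm * Metric.infDist y A)
    (hbox : k = 1 → (fun ε : ℝ => Distortion.boxCount A ε)
      =O[𝓝[>] 0] (fun ε : ℝ => ε ^ (-Distortion.boxDim A))) :
    ∃ C ε₀ : ℝ, 0 < C ∧ 0 < ε₀ ∧ ∀ ε : ℝ, 0 < ε → ε < ε₀ →
      (Distortion.distortionComplexity U ε A : ENNReal) ≤
        ENNReal.ofReal
          (C * ε ^ (-(Distortion.boxDim A * (lp - lm / k) / (lp - lm))) *
            Real.log ε⁻¹ ^ 2) := by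
  obtain ⟨hW, -, -, hfW, -, -⟩ := hf
  obtain ⟨-, hne, hAc, hfA, -⟩ := hA
  suffices h : ∃ C : ℝ, 0 < C ∧ ∀ᶠ ε : ℝ in 𝓝[>] 0,
      (Distortion.distortionComplexity U ε A : ENNReal) ≤ ENNReal.ofReal
        (C * ε ^ (-(Distortion.boxDim A * (lp - lm / k) / (lp - lm))) * Real.log ε⁻¹ ^ 2) by
    obtain ⟨C, hC, h⟩ := h
    obtain ⟨ε₀, hε₀, h⟩ := mem_nhdsGT_iff_exists_Ioo_subset.1 h
    exact ⟨C, ε₀, hC, hε₀, fun ε h0 h1 => h ⟨h0, h1⟩⟩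
  have hll : 0 < lp - lm := by linarith
  have hdim0 := Distortion.boxDim_nonneg hAc hne
  rcases hk.eq_or_lt with rfl | hk2
  · have e : Distortion.boxDim A * (lp - lm / (1 : ℕ)) / (lp - lm) = Distortion.boxDim A := by
      rw [Nat.cast_one, div_one, mul_div_assoc, div_self hll.ne', mul_one]
    rw [e]
    obtain ⟨C₀, hC₀⟩ := (hbox rfl).bound
    refine Distortion.exists_distortionComplexity_le_of_boxCount_le hU hAc hne (C₀ := C₀) ?_
    filter_upwards [hC₀, self_mem_nhdsWithin] with ε h1 (h2 : 0 < ε)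
    rw [Real.norm_of_nonneg (Real.rpow_nonneg h2.le _)] at h1
    exact (le_abs_self _).trans h1
  have hk2' : (2 : ℝ) ≤ k := by exact_mod_cast hk2
  have hfd : ∀ x ∈ V, ContDiffAt ℝ k f x := fun x hx => hfW.contDiffAt (hW.mem_nhds (hVW hx))
  have hlmk : 0 < lp - lm / k := by
    have : lm / k < 0 := div_neg_of_neg_of_pos hlm (by linarith)
    linarith
  -- Bounded covering numbers are settled by a list, since `ε` has a nonpositive exponent in the
  -- bound. Otherwise the dimension is positive, which the strict inequality `hs` below requires.
  rcases Distortion.boxCount_bounded_or_boxDim_pos hAc hne hfA hAV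
    (fun x hx => (hfd x hx).of_le (by exact_mod_cast hk)) hhyp hlm hcontr with ⟨N₀, hN₀⟩ | hpos
  · refine Distortion.exists_distortionComplexity_le_of_boxCount_le hU hAc hne (C₀ := |N₀|) ?_
    filter_upwards [Distortion.eventually_pos_lt one_pos] with ε hε
    refine (hN₀ ε hε.1).trans ((le_abs_self N₀).trans (le_mul_of_one_le_right (abs_nonneg _) ?_))
    refine Real.one_le_rpow_of_pos_of_le_one_of_nonpos hε.1 hε.2.le ?_
    rw [neg_nonpos]
    exact div_nonneg (mul_nonneg hdim0 hlmk.le) hll.le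
  obtain ⟨r, hr, hrV⟩ := Distortion.exists_infDist_le_subset hAc hne hAV
  obtain ⟨θ, β, hθ0, hθ1, hβ0, hθα, hc, he⟩ :=
    Distortion.exists_exponents (a := -lm) (by linarith) hlp hk2
  set D := Distortion.boxDim A with hD
  have hα : θ < (lp - lm / k) / (lp - lm) := by
    have e : (lp + -lm / k) / (lp + -lm) = (lp - lm / k) / (lp - lm) := by ring_nf
    rwa [e] at hθα
  -- This `s` is chosen so that `θ * s` is exactly the exponent claimed. It exceeds the dimension
  -- because `θ` lies strictly below the ratio.
  have hs : D < D * ((lp - lm / k) / (lp - lm)) / θ := by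
    rw [lt_div_iff₀ hθ0]
    exact mul_lt_mul_of_pos_left hα hpos
  refine Distortion.exists_distortionComplexity_le_of_smooth (by omega) hk2 hU hAc hne hfA hW hfW
    hr (fun y hy => hVW (hrV y hy)) hlm hlp (fun y hy => hcontr y (hrV y hy)) ?_ hθ0 hθ1 hβ0 hc he
    (hdim0.trans hs.le) (le_of_eq ?_) (Distortion.eventually_boxCount_le hAc hne hs)
  -- The balls of radius `r` about points of `A` lie in `V` and are convex, so the derivative bound
  -- gives the Lipschitz bound there.
  · intro a ha y hy
    have hball : ∀ z ∈ Metric.closedBall a r, z ∈ V := fun z hz =>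
      hrV z ((Metric.infDist_le_dist_of_mem ha).trans (Metric.mem_closedBall.1 hz))
    exact (convex_closedBall a r).norm_image_sub_le_of_norm_fderiv_le (𝕜 := ℝ)
      (fun z hz => (hfd z (hball z hz)).differentiableAt (by
        have : k ≠ 0 := by omega
        exact_mod_cast this))
      (fun z hz => hexp z (hball z hz)) (Metric.mem_closedBall_self hr.le)
      (by rwa [Metric.mem_closedBall, dist_eq_norm])
  · field_simp
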